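/- Let $m\ge 1$, let $e_0,e_1,\dots,e_m$ be the standard generators of the real Clifford algebra $\mathbb{R}_{0,m+1}$, so that $e_\alpha e_\beta+e_\beta e_\alpha=-2\delta_{\alpha\beta}$, let $\overline{e_0}=-e_0$, and identify $(x_0,\dots,x_m)\in\mathbb{R}^{m+1}$ with $x=x_0e_0+\underline{x}$, $\underline{x}=\sum_{j=1}^m x_je_j$. Let $\underline{\partial}=\sum_{j=1}^m e_j\partial_{x_j}$ be the Dirac operator, $D=\frac12(\partial_{x_0}+\overline{e_0}\,\underline{\partial})$ the generalized Cauchy--Riemann operator and $\overline{D}=\frac12(\partial_{x_0}-\overline{e_0}\,\underline{\partial})$ its conjugate. A continuously differentiable $\mathbb{R}_{0,m+1}$-valued function $F$ on an open set is called left monogenic if $DF=0$ and right monogenic if $FD:=\frac12\bigl(\partial_{x_0}F+\sum_{j=1}^m(\partial_{x_j}F)\,\overline{e_0}e_j\bigr)=0$ there. Let $\sigma_{m+1}=2\pi^{(m+1)/2}/\Gamma(\frac{m+1}{2})$ and define the downstream potentials on $\mathbb{R}^{m+1}\setminus\{0\}$ by $$C_{-1}(x)=\frac{1}{\sigma_{m+1}}\frac{x\,\overline{e_0}}{|x|^{m+1}},\qquad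 C_{-k-1}=\overline{D}^{\,k}C_{-1}\quad(k\ge 1);$$ let $C_{-k}^{+}$ and $C_{-k}^{-}$ be the restrictions of $C_{-k}$ to the half-spaces $\mathbb{R}^{m+1}_+=\{x_0>0\}$ and $\mathbb{R}^{m+1}_-=\{x_0<0\}$. Let $\delta$ be the delta distribution and $H=-\frac{2}{\sigma_{m+1}}\,\mathrm{Pv}\,\frac{\underline{\omega}}{r^m}$ the Hilbert kernel in $\mathbb{R}^m$, where $r=|\underline{x}|$ and $\underline{\omega}=\underline{x}/r$, and let $\underline{\partial}^n\delta$ and $\underline{\partial}^nH$ be obtained from these tempered distributions by applying the distributional Dirac operator $n$ times (from the left). For an $\mathbb{R}_{0,m+1}$-valued tempered distribution $T$ on $\mathbb{R}^m$, write $T\leftrightarrow(F,G)$ if $T=\lim_{x_0\to0+}F(x_0,\cdot)-\lim_{x_0\to0-}G(x_0,\cdot)$, where both limits exist in the sense of tempered distributions and where $F$ and $G$ are right monogenic in $\mathbb{R}^{m+1}_+$ and in $\mathbb{R}^{m+1}_-$, respectively. Then for every $\ell\ge1$ the potentials $C_{-2\ell}$ and $C_{-2\ell-1}$ are both left and right monogenic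 in $\mathbb{R}^{m+1}\setminus\{0\}$, and $$\underline{\partial}^{2\ell-1}\delta\leftrightarrow(\overline{e_0}\,C_{-2\ell}^+,\ \overline{e_0}\,C_{-2\ell}^-),\qquad \underline{\partial}^{2\ell-1}H\leftrightarrow(-C_{-2\ell}^+,\ C_{-2\ell}^-),$$ $$\underline{\partial}^{2\ell}\delta\leftrightarrow(C_{-2\ell-1}^+,\ C_{-2\ell-1}^-),\qquad \underline{\partial}^{2\ell}H\leftrightarrow(e_0\,C_{-2\ell-1}^+,\ \overline{e_0}\,C_{-2\ell-1}^-).$$ In the representations of $\underline{\partial}^{2\ell-1}H$ and of $\underline{\partial}^{2\ell}\delta$ the functions of the pair are moreover left monogenic. -/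

import Mathlib

open Real Set Filter Topology MeasureTheory
open scoped SchwartzMap

noncomputable section

namespace CliffordHyper

/-! ### Euclidean spaces and the real Clifford algebra of signature `(0, m + 1)` -/

/-- The space `ℝ^m`, which is identified with the hyperplane `x₀ = 0` of `ℝ^(m+1)`. -/
abbrev Base (m : ℕ) : Type := EuclideanSpace ℝ (Fin m)

/-- The space `ℝ^(m+1)`, with coordinates `x₀, x₁, …, x_m`. -/
abbrev Full (m : ℕ) : Type := EuclideanSpace ℝ (Fin (m + 1))

/-- The point `(x₀, x_1, …, x_m)`. -/
def point {m : ℕ} (x₀ : ℝ) (x : Base m) : Full m :=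
  WithLp.toLp 2 (Fin.cons x₀ x.ofLp)

/-- The quadratic form `x ↦ -|x|²` on `ℝ^(m+1)`. -/
def negForm (m : ℕ) : QuadraticForm ℝ (Full m) :=
  -LinearMap.BilinMap.toQuadraticMap (innerₗ (Full m))

theorem negForm_apply {m : ℕ} (x : Full m) : negForm m x = -‖x‖ ^ 2 := by
  simp [negForm, LinearMap.BilinMap.toQuadraticMap_apply]

/-- The universal real Clifford algebra `ℝ_{0,m+1}`. -/
abbrev Cl (m : ℕ) : Type := CliffordAlgebra (negForm m)

/-- A point of `ℝ^(m+1)` as a Clifford vector `x = x₀ e₀ + x₁ e₁ + ⋯ + x_m e_m`. -/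
def vec {m : ℕ} (x : Full m) : Cl m := CliffordAlgebra.ι (negForm m) x

/-- The generators `e₀, e₁, …, e_m`. -/
def e {m : ℕ} (i : Fin (m + 1)) : Cl m := vec (EuclideanSpace.single i 1)

/-- The Clifford conjugate of `e₀` (`star` is Clifford conjugation, so this is `-e₀`). -/
def e0bar (m : ℕ) : Cl m := star (e 0)

theorem e0bar_eq (m : ℕ) : e0bar m = -e 0 := by
  simp [e0bar, e, vec]

theorem exteriorAlgebra_finite (V : Type*) [AddCommGroup V] [Module ℝ V] [Module.Finite ℝ V] :
    Module.Finite ℝ (ExteriorAlgebra ℝ V) := by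
  have htop : (⨆ n : ℕ, (⋀[ℝ]^n V : Submodule ℝ (ExteriorAlgebra ℝ V))) = ⊤ :=
    (DirectSum.Decomposition.isInternal
      (fun n : ℕ => (⋀[ℝ]^n V : Submodule ℝ (ExteriorAlgebra ℝ V)))).submodule_iSup_eq_top
  have hbot : ∀ n : ℕ, Module.finrank ℝ V < n →
      (⋀[ℝ]^n V : Submodule ℝ (ExteriorAlgebra ℝ V)) = ⊥ := by
    intro n hn
    apply Submodule.finrank_eq_zero.mp
    rw [exteriorPower.finrank_eq, Nat.choose_eq_zero_of_lt hn]
  have hle : (⊤ : Submodule ℝ (ExteriorAlgebra ℝ V)) =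
      ⨆ n : Fin (Module.finrank ℝ V + 1), (⋀[ℝ]^(n : ℕ) V : Submodule ℝ (ExteriorAlgebra ℝ V)) := by
    apply le_antisymm _ le_top
    rw [← htop]
    refine iSup_le fun n => ?_
    by_cases hn : Module.finrank ℝ V < n
    · rw [hbot n hn]; exact bot_le
    · exact le_iSup (fun n : Fin (Module.finrank ℝ V + 1) =>
        (⋀[ℝ]^(n : ℕ) V : Submodule ℝ (ExteriorAlgebra ℝ V))) ⟨n, by omega⟩
  refine ⟨?_⟩
  rw [hle]
  exact Submodule.fg_iSup _ fun n => Module.Finite.iff_fg.mp inferInstance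

instance instFiniteCl (m : ℕ) : Module.Finite ℝ (Cl m) :=
  haveI := exteriorAlgebra_finite (Full m)
  Module.Finite.equiv (CliffordAlgebra.equivExterior (negForm m)).symm

/-- Coordinates on the finite dimensional space `ℝ_{0,m+1}`. -/
def coords (m : ℕ) : Cl m ≃ₗ[ℝ] (Fin (Module.finrank ℝ (Cl m)) → ℝ) :=
  (Module.finBasis ℝ (Cl m)).equivFun

/-- A norm on the finite dimensional real vector space `ℝ_{0,m+1}`; all norms on it are equivalent,
so limits, derivatives and integrals do not depend on the choice. -/
instance instNormedAddCommGroupCl (m : ℕ) : NormedAddCommGroup (Cl m) :=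
  NormedAddCommGroup.induced (Cl m) (Fin (Module.finrank ℝ (Cl m)) → ℝ) (coords m)
    (coords m).injective

instance instNormedSpaceCl (m : ℕ) : NormedSpace ℝ (Cl m) :=
  NormedSpace.induced ℝ (Cl m) (Fin (Module.finrank ℝ (Cl m)) → ℝ) (coords m)

/-! ### The generalized Cauchy–Riemann operator and monogenic functions -/

/-- The partial derivative `∂F/∂x_i`. -/
def partialD {m : ℕ} (i : Fin (m + 1)) (F : Full m → Cl m) (x : Full m) : Cl m :=
  fderiv ℝ F x (EuclideanSpace.single i 1)

/-- The Cauchy–Riemann operator acting from the left,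
`D F = (1/2) (∂_{x₀} F + ē₀ ∑ e_j ∂_{x_j} F)`. -/
def crLeft {m : ℕ} (F : Full m → Cl m) (x : Full m) : Cl m :=
  (1 / 2 : ℝ) • (partialD 0 F x + e0bar m * ∑ j : Fin m, e j.succ * partialD j.succ F x)

/-- The Cauchy–Riemann operator acting from the right,
`F D = (1/2) (∂_{x₀} F + ∑ (∂_{x_j} F) ē₀ e_j)`. -/
def crRight {m : ℕ} (F : Full m → Cl m) (x : Full m) : Cl m :=
  (1 / 2 : ℝ) • (partialD 0 F x + ∑ j : Fin m, partialD j.succ F x * (e0bar m * e j.succ))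

/-- The conjugate Cauchy–Riemann operator (acting from the left),
`D̄ F = (1/2) (∂_{x₀} F - ē₀ ∑ e_j ∂_{x_j} F)`. -/
def crConj {m : ℕ} (F : Full m → Cl m) (x : Full m) : Cl m :=
  (1 / 2 : ℝ) • (partialD 0 F x - e0bar m * ∑ j : Fin m, e j.succ * partialD j.succ F x)

/-- Left monogenic functions: continuously differentiable with `D F = 0`. -/
def LeftMonogenicOn {m : ℕ} (F : Full m → Cl m) (Ω : Set (Full m)) : Prop :=
  ContDiffOn ℝ 1 F Ω ∧ ∀ x ∈ Ω, crLeft F x = 0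

/-- Right monogenic functions: continuously differentiable with `F D = 0`. -/
def RightMonogenicOn {m : ℕ} (F : Full m → Cl m) (Ω : Set (Full m)) : Prop :=
  ContDiffOn ℝ 1 F Ω ∧ ∀ x ∈ Ω, crRight F x = 0

/-- The open upper half-space. -/
def upper (m : ℕ) : Set (Full m) := {x | 0 < x 0}

/-- The open lower half-space. -/
def lower (m : ℕ) : Set (Full m) := {x | x 0 < 0}

/-! ### The Cauchy kernel and the downstream potentials -/

/-- The area `σ_n = 2 π^(n/2) / Γ(n/2)` of the unit sphere `S^(n-1)` of `ℝ^n`. -/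
def sphereArea (n : ℕ) : ℝ := 2 * π ^ ((n : ℝ) / 2) / Real.Gamma ((n : ℝ) / 2)

/-- The Cauchy kernel `C_{-1}(x) = (1/σ_{m+1}) x ē₀ / |x|^(m+1)`. -/
def cauchyKernel (m : ℕ) (x : Full m) : Cl m :=
  (1 / sphereArea (m + 1) * (1 / ‖x‖ ^ (m + 1))) • (vec x * e0bar m)

/-- The downstream potential `C_{-k-1} = D̄^k C_{-1}`. -/
def potential (m k : ℕ) : Full m → Cl m := crConj^[k] (cauchyKernel m)

/-! ### Clifford algebra valued distributions on `ℝ^m` -/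

/-- Tempered distributions on `ℝ^m` with values in `ℝ_{0,m+1}`. -/
abbrev Distr (m : ℕ) : Type := 𝓢(Base m, ℝ) →L[ℝ] Cl m

/-- Left multiplication by a Clifford number. -/
def mulLeftCLM {m : ℕ} (a : Cl m) : Cl m →L[ℝ] Cl m :=
  LinearMap.toContinuousLinearMap (LinearMap.mulLeft ℝ a)

/-- The Dirac operator `∂ = ∑_{j=1}^m e_j ∂_{x_j}` on distributions:
`⟨∂ T, φ⟩ = - ∑_j e_j ⟨T, ∂_{x_j} φ⟩`. -/
def dirac {m : ℕ} (T : Distr m) : Distr m :=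
  -∑ j : Fin m, mulLeftCLM (e j.succ) ∘L T ∘L
    LineDeriv.lineDerivOpCLM ℝ 𝓢(Base m, ℝ) (EuclideanSpace.single j (1 : ℝ))

theorem dirac_apply {m : ℕ} (T : Distr m) (φ : 𝓢(Base m, ℝ)) :
    dirac T φ = -∑ j : Fin m, e j.succ *
      T (LineDeriv.lineDerivOp (EuclideanSpace.single j (1 : ℝ)) φ) := by
  simp [dirac, mulLeftCLM]

/-- The delta distribution `⟨δ, φ⟩ = φ(0)`. -/
def delta (m : ℕ) : Distr m :=
  (ContinuousLinearMap.toSpanSingleton ℝ (1 : Cl m)) ∘L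
    (BoundedContinuousFunction.evalCLM ℝ (0 : Base m)) ∘L
      (SchwartzMap.toBoundedContinuousFunctionCLM ℝ (Base m) ℝ)

theorem delta_apply {m : ℕ} (φ : 𝓢(Base m, ℝ)) : delta m φ = φ 0 • (1 : Cl m) := by
  simp [delta]

/-- The underscored Clifford vector `x_1 e_1 + ⋯ + x_m e_m` of a point of `ℝ^m`. -/
def baseVec {m : ℕ} (x : Base m) : Cl m := vec (point 0 x)

/-- The function `-(2/σ_{m+1}) ω / r^m`, where `r = |x|` and `ω = x / r`. -/
def hilbertFun (m : ℕ) (x : Base m) : Cl m :=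
  (-(2 / sphereArea (m + 1)) * (1 / ‖x‖ ^ m)) • ((1 / ‖x‖) • baseVec x)

theorem point_add {m : ℕ} (a b : ℝ) (x y : Base m) :
    point (a + b) (x + y) = point a x + point b y := by
  ext i
  refine Fin.cases ?_ (fun j => ?_) i <;> simp [point]

theorem point_smul {m : ℕ} (c a : ℝ) (x : Base m) :
    point (c * a) (c • x) = c • point a x := by
  ext i
  refine Fin.cases ?_ (fun j => ?_) i <;> simp [point]

/-- `baseVec` as a linear map. -/
def baseVecLin (m : ℕ) : Base m →ₗ[ℝ] Cl m where
  toFun := baseVec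
  map_add' x y := by
    have := point_add (0 : ℝ) 0 x y
    simp only [add_zero] at this
    simp [baseVec, vec, this]
  map_smul' c x := by
    have := point_smul c (0 : ℝ) x
    simp only [mul_zero] at this
    simp [baseVec, vec, this]

theorem exists_baseVec_bound (m : ℕ) : ∃ C : ℝ, 0 ≤ C ∧ ∀ x : Base m, ‖baseVec x‖ ≤ C * ‖x‖ :=
  ⟨‖LinearMap.toContinuousLinearMap (baseVecLin m)‖, norm_nonneg _,
    fun x => (LinearMap.toContinuousLinearMap (baseVecLin m)).le_opNorm x⟩

theorem continuous_baseVec (m : ℕ) : Continuous (baseVec : Base m → Cl m) :=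
  (LinearMap.toContinuousLinearMap (baseVecLin m)).continuous

theorem hilbertFun_neg {m : ℕ} (x : Base m) : hilbertFun m (-x) = -hilbertFun m x := by
  have : baseVec (-x) = -baseVec x := (baseVecLin m).map_neg x
  simp [hilbertFun, this]

theorem measurable_hilbertFun (m : ℕ) : AEStronglyMeasurable (hilbertFun m) volume := by
  unfold hilbertFun
  have h1 : Measurable fun x : Base m => -(2 / sphereArea (m + 1)) * (1 / ‖x‖ ^ m) := by fun_prop
  have h2 : Measurable fun x : Base m => 1 / ‖x‖ := by fun_prop
  exact h1.aestronglyMeasurable.smul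
    (h2.aestronglyMeasurable.smul (continuous_baseVec m).aestronglyMeasurable)

theorem hilbertFun_bound (m : ℕ) :
    ∃ C : ℝ, 0 ≤ C ∧ ∀ x : Base m, ‖hilbertFun m x‖ ≤ C * (‖x‖ ^ m)⁻¹ := by
  obtain ⟨C, hC, h⟩ := exists_baseVec_bound m
  refine ⟨|2 / sphereArea (m + 1)| * C, by positivity, fun x => ?_⟩
  have h3 : ‖(1 / ‖x‖) • baseVec x‖ ≤ C := by
    rw [norm_smul]
    by_cases hx : x = 0
    · simp [hx, hC]
    · have hx' : 0 < ‖x‖ := norm_pos_iff.mpr hx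
      have := h x
      rw [Real.norm_of_nonneg (by positivity), one_div, inv_mul_le_iff₀ hx']
      linarith
  unfold hilbertFun
  rw [norm_smul, norm_mul, norm_neg, Real.norm_eq_abs, one_div,
    Real.norm_of_nonneg (r := (‖x‖ ^ m)⁻¹) (by positivity)]
  calc _ ≤ |2 / sphereArea (m + 1)| * (‖x‖ ^ m)⁻¹ * C := by gcongr
    _ = _ := by ring

theorem integrable_weight (m : ℕ) [NeZero m] :
    Integrable (fun x : Base m => ‖x‖ * (‖x‖ ^ m)⁻¹ * (1 + ‖x‖ ^ 2)⁻¹) := by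
  have hm : 0 < m := Nat.pos_of_ne_zero (NeZero.ne m)
  have key := (integrable_fun_norm_addHaar (volume : Measure (Base m))
    (f := fun y : ℝ => y * (y ^ m)⁻¹ * (1 + y ^ 2)⁻¹)).mpr
  apply key
  refine (integrable_inv_one_add_sq.integrableOn (s := Ioi (0 : ℝ))).congr_fun ?_ measurableSet_Ioi
  intro y hy
  have hy' : (0 : ℝ) < y := hy
  obtain ⟨n, rfl⟩ : ∃ n, m = n + 1 := ⟨m - 1, by omega⟩
  simp only [finrank_euclideanSpace, Fintype.card_fin, smul_eq_mul, Nat.add_sub_cancel]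
  field_simp
  ring

/-- The odd part of a test function times the Hilbert kernel function. -/
def symPart {m : ℕ} (φ : 𝓢(Base m, ℝ)) (x : Base m) : Cl m :=
  (1 / 2 * (φ x - φ (-x))) • hilbertFun m x

theorem odd_part_bound {m : ℕ} (φ : 𝓢(Base m, ℝ)) (x : Base m) :
    |1 / 2 * (φ x - φ (-x))| ≤
      (SchwartzMap.seminorm ℝ 0 1 φ + SchwartzMap.seminorm ℝ 1 0 φ) *
        (‖x‖ * (1 + ‖x‖ ^ 2)⁻¹) := by
  have h1 : ‖φ x - φ (-x)‖ ≤ SchwartzMap.seminorm ℝ 0 1 φ * ‖x - -x‖ := by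
    refine Convex.norm_image_sub_le_of_norm_fderiv_le (𝕜 := ℝ) (s := Set.univ)
      (fun y _ => φ.differentiableAt) (fun y _ => ?_) convex_univ (mem_univ _) (mem_univ _)
    rw [← norm_iteratedFDeriv_one]
    exact SchwartzMap.norm_iteratedFDeriv_le_seminorm ℝ φ 1 y
  have h2 : ‖x - -x‖ = 2 * ‖x‖ := by
    rw [sub_neg_eq_add, ← two_smul ℝ x, norm_smul]; simp
  have h3 := SchwartzMap.norm_pow_mul_le_seminorm ℝ φ 1 x
  have h4 := SchwartzMap.norm_pow_mul_le_seminorm ℝ φ 1 (-x)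
  have h5 := norm_sub_le (φ x) (φ (-x))
  rw [h2] at h1
  simp only [norm_neg, pow_one] at h3 h4
  rw [abs_mul, ← Real.norm_eq_abs (φ x - φ (-x)), abs_of_pos (by norm_num : (0 : ℝ) < 1 / 2),
    ← mul_assoc, ← div_eq_mul_inv, le_div_iff₀ (by positivity)]
  have h6 : ‖x‖ * ‖φ x - φ (-x)‖ ≤ 2 * SchwartzMap.seminorm ℝ 1 0 φ := by
    nlinarith [mul_le_mul_of_nonneg_left h5 (norm_nonneg x)]
  nlinarith [mul_le_mul_of_nonneg_left h6 (norm_nonneg x)]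

theorem symPart_bound (m : ℕ) : ∃ C : ℝ, 0 ≤ C ∧ ∀ (φ : 𝓢(Base m, ℝ)) (x : Base m),
    ‖symPart φ x‖ ≤ C * (SchwartzMap.seminorm ℝ 0 1 φ + SchwartzMap.seminorm ℝ 1 0 φ) *
      (‖x‖ * (‖x‖ ^ m)⁻¹ * (1 + ‖x‖ ^ 2)⁻¹) := by
  obtain ⟨C, hC, h⟩ := hilbertFun_bound m
  refine ⟨C, hC, fun φ x => ?_⟩
  have h1 := odd_part_bound φ x
  rw [symPart, norm_smul, Real.norm_eq_abs]
  calc _ ≤ ((SchwartzMap.seminorm ℝ 0 1 φ + SchwartzMap.seminorm ℝ 1 0 φ) *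
        (‖x‖ * (1 + ‖x‖ ^ 2)⁻¹)) * (C * (‖x‖ ^ m)⁻¹) :=
        mul_le_mul h1 (h x) (norm_nonneg _) ((abs_nonneg _).trans h1)
    _ = _ := by ring

theorem integrable_symPart {m : ℕ} [NeZero m] (φ : 𝓢(Base m, ℝ)) : Integrable (symPart φ) := by
  obtain ⟨C, -, h⟩ := symPart_bound m
  refine Integrable.mono' ((integrable_weight m).const_mul _) ?_ (ae_of_all _ (h φ))
  have h1 : Continuous fun x => 1 / 2 * (φ x - φ (-x)) := by
    have := φ.continuous
    fun_prop
  exact h1.aestronglyMeasurable.smul (measurable_hilbertFun m)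

theorem integrableOn_truncated {m : ℕ} (φ : 𝓢(Base m, ℝ)) {ε : ℝ} (hε : 0 < ε) :
    IntegrableOn (fun x => φ x • hilbertFun m x) {x : Base m | ε < ‖x‖} := by
  obtain ⟨C, hC, h⟩ := hilbertFun_bound m
  refine Integrable.mono' (φ.integrable.norm.mul_const (C * (ε ^ m)⁻¹)).integrableOn
    (φ.continuous.aestronglyMeasurable.smul (measurable_hilbertFun m)).restrict ?_
  refine (ae_restrict_iff' (measurableSet_lt measurable_const measurable_norm)).mpr
    (ae_of_all _ fun x hx => ?_)
  have hx' : ε < ‖x‖ := hx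
  rw [norm_smul]
  refine mul_le_mul_of_nonneg_left ((h x).trans ?_) (norm_nonneg _)
  gcongr

theorem integral_truncated {m : ℕ} (φ : 𝓢(Base m, ℝ)) {ε : ℝ} (hε : 0 < ε) :
    ∫ x in {x : Base m | ε < ‖x‖}, φ x • hilbertFun m x =
      ∫ x in {x : Base m | ε < ‖x‖}, symPart φ x := by
  have hS : MeasurableSet {x : Base m | ε < ‖x‖} := measurableSet_lt measurable_const measurable_norm
  have hpre : (fun x : Base m => -x) ⁻¹' {x : Base m | ε < ‖x‖} = {x : Base m | ε < ‖x‖} := by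
    ext x; simp
  have hmp : MeasurePreserving (fun x : Base m => -x) volume volume :=
    Measure.measurePreserving_neg _
  have hemb : MeasurableEmbedding (fun x : Base m => -x) :=
    (Homeomorph.neg (Base m)).measurableEmbedding
  have hI := integrableOn_truncated φ hε
  have hrefl : ∫ x in {x : Base m | ε < ‖x‖}, φ (-x) • hilbertFun m x =
      -∫ x in {x : Base m | ε < ‖x‖}, φ x • hilbertFun m x := by
    have h := hmp.setIntegral_preimage_emb hemb (fun x => φ x • hilbertFun m x)
      {x : Base m | ε < ‖x‖}
    rw [hpre] at h
    rw [← h, ← integral_neg]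
    simp [hilbertFun_neg]
  have hI' : IntegrableOn (fun x => φ (-x) • hilbertFun m x) {x : Base m | ε < ‖x‖} := by
    have h := (hmp.integrableOn_comp_preimage hemb (f := fun x => φ x • hilbertFun m x)
      (s := {x : Base m | ε < ‖x‖})).mpr hI
    rw [hpre] at h
    refine h.neg.congr (ae_of_all _ fun x => ?_)
    simp [hilbertFun_neg]
  have hsym : ∀ x, symPart φ x =
      (1 / 2 : ℝ) • (φ x • hilbertFun m x - φ (-x) • hilbertFun m x) := by
    intro x
    rw [symPart, mul_smul, sub_smul]
  simp_rw [hsym]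
  rw [integral_smul, integral_sub hI hI', hrefl, sub_neg_eq_add, ← two_smul ℝ, smul_smul]
  norm_num

theorem exists_hilbertKernel (m : ℕ) [NeZero m] : ∃ H : Distr m, ∀ φ : 𝓢(Base m, ℝ),
    Tendsto (fun ε : ℝ => ∫ x in {x : Base m | ε < ‖x‖}, φ x • hilbertFun m x)
      (𝓝[>] 0) (𝓝 (H φ)) := by
  obtain ⟨C, hC, hb⟩ := symPart_bound m
  refine ⟨SchwartzMap.mkCLMtoNormedSpace (σ := RingHom.id ℝ)
    (fun φ => ∫ x, symPart φ x) ?_ ?_ ?_, fun φ => ?_⟩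
  · intro f g
    rw [← integral_add (integrable_symPart f) (integrable_symPart g)]
    congr 1
    ext x
    simp only [symPart, ← add_smul, _root_.add_apply]
    congr 1
    ring
  · intro a f
    rw [RingHom.id_apply, ← integral_smul]
    congr 1
    ext x
    simp only [symPart, smul_smul, _root_.smul_apply, smul_eq_mul]
    congr 1
    ring
  · refine ⟨{(0, 1), (1, 0)},
      C * 2 * ∫ x : Base m, ‖x‖ * (‖x‖ ^ m)⁻¹ * (1 + ‖x‖ ^ 2)⁻¹, ?_, fun f => ?_⟩
    · have : 0 ≤ ∫ x : Base m, ‖x‖ * (‖x‖ ^ m)⁻¹ * (1 + ‖x‖ ^ 2)⁻¹ :=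
        integral_nonneg fun x => by positivity
      positivity
    · have h1 : SchwartzMap.seminorm ℝ 0 1 f ≤
          (({(0, 1), (1, 0)} : Finset (ℕ × ℕ)).sup (schwartzSeminormFamily ℝ (Base m) ℝ)) f :=
        Seminorm.le_finset_sup_apply (p := schwartzSeminormFamily ℝ (Base m) ℝ)
          (i := ((0, 1) : ℕ × ℕ)) (by simp)
      have h2 : SchwartzMap.seminorm ℝ 1 0 f ≤
          (({(0, 1), (1, 0)} : Finset (ℕ × ℕ)).sup (schwartzSeminormFamily ℝ (Base m) ℝ)) f :=
        Seminorm.le_finset_sup_apply (p := schwartzSeminormFamily ℝ (Base m) ℝ)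
          (i := ((1, 0) : ℕ × ℕ)) (by simp)
      have h3 : 0 ≤ ∫ x : Base m, ‖x‖ * (‖x‖ ^ m)⁻¹ * (1 + ‖x‖ ^ 2)⁻¹ :=
        integral_nonneg fun x => by positivity
      have h4 := norm_integral_le_of_norm_le ((integrable_weight m).const_mul _)
        (ae_of_all volume (hb f))
      rw [integral_const_mul] at h4
      refine h4.trans ?_
      have h5 : SchwartzMap.seminorm ℝ 0 1 f + SchwartzMap.seminorm ℝ 1 0 f ≤ 2 *
          (({(0, 1), (1, 0)} : Finset (ℕ × ℕ)).sup (schwartzSeminormFamily ℝ (Base m) ℝ)) f := by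
        linarith
      calc _ ≤ C * (2 * (({(0, 1), (1, 0)} : Finset (ℕ × ℕ)).sup
            (schwartzSeminormFamily ℝ (Base m) ℝ)) f) *
            ∫ x : Base m, ‖x‖ * (‖x‖ ^ m)⁻¹ * (1 + ‖x‖ ^ 2)⁻¹ := by gcongr
        _ = _ := by ring
  · have hlim : Tendsto (fun ε : ℝ => ∫ x, {x : Base m | ε < ‖x‖}.indicator (symPart φ) x)
        (𝓝[>] 0) (𝓝 (∫ x, symPart φ x)) := by
      refine tendsto_integral_filter_of_dominated_convergence (fun x => ‖symPart φ x‖) ?_ ?_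
        (integrable_symPart φ).norm ?_
      · exact Eventually.of_forall fun ε =>
          (integrable_symPart φ).aestronglyMeasurable.indicator
            (measurableSet_lt measurable_const measurable_norm)
      · exact Eventually.of_forall fun ε => ae_of_all _ fun x => norm_indicator_le_norm_self _ _
      · refine ae_of_all _ fun x => ?_
        by_cases hx : x = 0
        · have : symPart φ x = 0 := by simp [symPart, hx]
          simp [Set.indicator_apply, this]
        · refine tendsto_const_nhds.congr' ?_
          filter_upwards [mem_nhdsWithin_of_mem_nhds (Iio_mem_nhds (norm_pos_iff.mpr hx))] with ε hε
          rw [Set.indicator_of_mem]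
          exact hε
    refine hlim.congr' ?_
    filter_upwards [self_mem_nhdsWithin] with ε hε
    rw [integral_truncated φ hε, integral_indicator (measurableSet_lt measurable_const measurable_norm)]

/-- The Hilbert kernel `H = -(2/σ_{m+1}) Pv (ω / r^m)`: the distribution given by the principal
value `⟨H, φ⟩ = lim_{ε → 0+} ∫_{|x| > ε} φ(x) (-(2/σ_{m+1}) ω / r^m) dx`. -/
def hilbertKernel (m : ℕ) [NeZero m] : Distr m := Classical.choose (exists_hilbertKernel m)

theorem hilbertKernel_spec (m : ℕ) [NeZero m] (φ : 𝓢(Base m, ℝ)) :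
    Tendsto (fun ε : ℝ => ∫ x in {x : Base m | ε < ‖x‖}, φ x • hilbertFun m x)
      (𝓝[>] 0) (𝓝 (hilbertKernel m φ)) :=
  Classical.choose_spec (exists_hilbertKernel m) φ

/-! ### Distributional boundary values and the jump across `ℝ^m` -/

/-- `T` is the limit, in the sense of distributions, of `F(x₀, ·)` as `x₀` runs through the
filter `l`; part of the claim is that `F(x₀, ·)` pairs with test functions by an absolutely
convergent integral. -/
def HasBoundaryValue {m : ℕ} (l : Filter ℝ) (F : Full m → Cl m) (T : Distr m) : Prop :=
  ∀ φ : 𝓢(Base m, ℝ),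
    (∀ᶠ x₀ in l, Integrable (fun x : Base m => φ x • F (point x₀ x))) ∧
    Tendsto (fun x₀ : ℝ => ∫ x : Base m, φ x • F (point x₀ x)) l (𝓝 (T φ))

/-- `T = lim_{x₀ → 0+} F(x₀, ·) - lim_{x₀ → 0-} G(x₀, ·)`, where both limits exist in the sense of
distributions. -/
def IsJump {m : ℕ} (T : Distr m) (F G : Full m → Cl m) : Prop :=
  ∃ cPlus cMinus : Distr m, HasBoundaryValue (𝓝[>] 0) F cPlus ∧
    HasBoundaryValue (𝓝[<] 0) G cMinus ∧ T = cPlus - cMinus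

/-- `T ↔ (F, G)`: `T` is the jump of `(F, G)`, with `F` and `G` left monogenic in the upper and in
the lower half-space. -/
def LeftRepresents {m : ℕ} (T : Distr m) (F G : Full m → Cl m) : Prop :=
  LeftMonogenicOn F (upper m) ∧ LeftMonogenicOn G (lower m) ∧ IsJump T F G

/-- `T ↔ (F, G)`: `T` is the jump of `(F, G)`, with `F` and `G` right monogenic in the upper and in
the lower half-space. -/
def RightRepresents {m : ℕ} (T : Distr m) (F G : Full m → Cl m) : Prop :=
  RightMonogenicOn F (upper m) ∧ RightMonogenicOn G (lower m) ∧ IsJump T F G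

end CliffordHyper

end

open CliffordHyper

/-! ### Smooth homogeneous functions on a punctured space -/

/-! Three facts carry the proof.

First, `D` and its conjugate add up to the derivative in `x₀`, so on left monogenic functions the
conjugate operator is just that derivative (`crConj_eq_partialD`). The Cauchy kernel is two-sided
monogenic off the origin, and the derivative in `x₀` commutes with both Cauchy–Riemann operators. By
induction (`potential_properties`) every potential is an iterated `x₀`-derivative of the Cauchy
kernel, two-sided monogenic, and homogeneous of negative degree.

Second, on the plane at height `a` the Cauchy kernel splits into the Poisson kernel and `ē₀` times
the conjugate Poisson kernel. The Poisson part is odd in `a` and tends to `±δ/2`; the conjugate part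
is even in `a` and tends to `ē₀ H / 2` from both sides. Thus the boundary values of `C_{-1}` are
`±δ/2 + ē₀ H / 2` (`hasBoundaryValue_cauchyKernel`).

Third, `D F = 0` says that the `x₀`-derivative of `F` equals `-ē₀ ∂ F`, with `∂` the Dirac operator
of `ℝ^m`. Integration by parts then shows that passing to the next potential applies `-ē₀ ∂` to the
boundary value (`HasBoundaryValue.of_partialD`). As `ē₀` anticommutes with each `e_j` and squares to
`-1`, the square of `-ē₀ ∂` is `∂²`. This gives the boundary values `±∂^n δ / 2 + ē₀ ∂^n H / 2` for
even `n` and `∓ē₀ ∂^n δ / 2 - ∂^n H / 2` for odd `n`.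

A difference of the two boundary values isolates `δ` and a sum isolates `H`; the factors `ē₀`, `e₀`
and `-1` normalise the result. Left multiplication by a constant preserves right monogenicity
(`RightMonogenicOn.mul_left`), and negation preserves both kinds. -/

namespace CliffordHyper

/-- Functions which are smooth and homogeneous of degree `-n` outside of the origin. -/
structure IsSmoothHomogeneous {V W : Type*} [NormedAddCommGroup V] [NormedSpace ℝ V]
    [NormedAddCommGroup W] [NormedSpace ℝ W] (n : ℕ) (F : V → W) : Prop where
  contDiffOn : ContDiffOn ℝ (⊤ : ℕ∞) F {0}ᶜ
  map_smul : ∀ t : ℝ, 0 < t → ∀ x : V, x ≠ 0 → F (t • x) = (t ^ n)⁻¹ • F x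

namespace IsSmoothHomogeneous

variable {V W : Type*} [NormedAddCommGroup V] [NormedSpace ℝ V]
    [NormedAddCommGroup W] [NormedSpace ℝ W] {n : ℕ} {F G : V → W}

theorem contDiffAt (hF : IsSmoothHomogeneous n F) {x : V} (hx : x ≠ 0) :
    ContDiffAt ℝ (⊤ : ℕ∞) F x :=
  hF.contDiffOn.contDiffAt (isOpen_compl_singleton.mem_nhds hx)

theorem differentiableAt (hF : IsSmoothHomogeneous n F) {x : V} (hx : x ≠ 0) :
    DifferentiableAt ℝ F x :=
  (hF.contDiffAt hx).differentiableAt (by simp)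

/-- Values at the origin are irrelevant. This is needed because the potentials are known to be
`x₀`-derivatives of one another only away from `0`. -/
theorem congr (hF : IsSmoothHomogeneous n F) (h : ∀ x, x ≠ 0 → G x = F x) :
    IsSmoothHomogeneous n G where
  contDiffOn := hF.contDiffOn.congr fun x hx => h x hx
  map_smul t ht x hx := by
    rw [h x hx, h _ (smul_ne_zero ht.ne' hx), hF.map_smul t ht x hx]

theorem fderiv_apply (hF : IsSmoothHomogeneous n F) (v : V) :
    IsSmoothHomogeneous (n + 1) fun x => fderiv ℝ F x v where
  contDiffOn := by
    have h : ContDiffOn ℝ (⊤ : ℕ∞) (fderiv ℝ F) {0}ᶜ :=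
      hF.contDiffOn.fderiv_of_isOpen isOpen_compl_singleton (by simp)
    exact h.clm_apply contDiffOn_const
  map_smul t ht x hx := by
    have h1 : fderiv ℝ (fun y => F (t • y)) x = (t ^ n)⁻¹ • fderiv ℝ F x := by
      have h2 : (fun y => F (t • y)) =ᶠ[𝓝 x] fun y => (t ^ n)⁻¹ • F y := by
        filter_upwards [isOpen_compl_singleton.mem_nhds hx] with y hy
        exact hF.map_smul t ht y hy
      rw [h2.fderiv_eq, fderiv_fun_const_smul (hF.differentiableAt hx)]
    -- The chain rule contributes a factor `t`; dividing by it raises the order of decay from `n` to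
    -- `n + 1`.
    have h3 : fderiv ℝ (fun y => F (t • y)) x = t • fderiv ℝ F (t • x) := by
      have h4 := ((hF.differentiableAt (smul_ne_zero ht.ne' hx)).hasFDerivAt.comp x
        ((hasFDerivAt_id x).const_smul t)).fderiv
      ext w
      have := congrArg (fun L : V →L[ℝ] W => L w) h4
      simpa [Function.comp_def] using this
    have h5 : fderiv ℝ F (t • x) = t⁻¹ • (t ^ n)⁻¹ • fderiv ℝ F x := by
      rw [← h1, h3, inv_smul_smul₀ ht.ne']
    rw [h5]
    simp only [_root_.smul_apply, smul_smul]
    congr 1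
    rw [pow_succ, mul_inv]
    ring

/-- The sphere of radius `a` is compact, and scaling outwards from it cannot increase the norm
because the degree `-n` is not positive. -/
theorem exists_norm_le [FiniteDimensional ℝ V] (hF : IsSmoothHomogeneous n F) {a : ℝ}
    (ha : 0 < a) : ∃ B, ∀ x, a ≤ ‖x‖ → ‖F x‖ ≤ B := by
  have hS : IsCompact (Metric.sphere (0 : V) a) :=
    haveI := FiniteDimensional.proper_real V
    isCompact_sphere 0 a
  have hne : ∀ x ∈ Metric.sphere (0 : V) a, x ≠ 0 := by
    rintro x hx rfl
    simp [ha.ne] at hx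
  obtain ⟨B, hB⟩ := hS.exists_bound_of_continuousOn
    (hF.contDiffOn.continuousOn.mono fun x hx => hne x hx)
  refine ⟨B, fun x hx => ?_⟩
  have hx0 : 0 < ‖x‖ := ha.trans_le hx
  have hy : (a / ‖x‖) • x ∈ Metric.sphere (0 : V) a := by
    rw [mem_sphere_zero_iff_norm, norm_smul, Real.norm_of_nonneg (by positivity)]
    field_simp
  have h1 : x = (‖x‖ / a) • (a / ‖x‖) • x := by
    rw [smul_smul]
    field_simp
    simp
  have h2 : 1 ≤ ‖x‖ / a := (one_le_div ha).mpr hx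
  rw [h1, hF.map_smul _ (by positivity) _ (hne _ hy), norm_smul,
    Real.norm_of_nonneg (by positivity)]
  calc _ ≤ 1 * ‖F ((a / ‖x‖) • x)‖ :=
        mul_le_mul_of_nonneg_right (inv_le_one_of_one_le₀ (one_le_pow₀ h2)) (norm_nonneg _)
    _ ≤ B := by rw [one_mul]; exact hB _ hy

/-- A first-order operator with constant coefficients, encoded as `Λ` acting on the derivative,
commutes with the derivative along `v` by symmetry of the second derivative. Hence solutions of `Λ
(fderiv ℝ F) = 0` stay solutions after differentiation. -/
theorem map_fderiv_fderiv_eq_zero (hF : IsSmoothHomogeneous n F) {U : Type*}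
    [NormedAddCommGroup U] [NormedSpace ℝ U] (Λ : (V →L[ℝ] W) →L[ℝ] U)
    (h : ∀ x, x ≠ 0 → Λ (fderiv ℝ F x) = 0) (v : V) {x : V} (hx : x ≠ 0) :
    Λ (fderiv ℝ (fun y => fderiv ℝ F y v) x) = 0 := by
  have hd : DifferentiableAt ℝ (fderiv ℝ F) x :=
    ((hF.contDiffAt hx).fderiv_right (m := 1) (by norm_cast)).differentiableAt (by simp)
  have hsymm : IsSymmSndFDerivAt ℝ F x := (hF.contDiffAt hx).isSymmSndFDerivAt (by simp; norm_cast)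
  have h1 : fderiv ℝ (fun y => fderiv ℝ F y v) x = fderiv ℝ (fderiv ℝ F) x v := by
    ext w
    rw [fderiv_clm_apply hd (differentiableAt_const v)]
    simpa using hsymm w v
  have h2 : fderiv ℝ (fun y => Λ (fderiv ℝ F y)) x = 0 := by
    have : (fun y => Λ (fderiv ℝ F y)) =ᶠ[𝓝 x] fun _ => 0 := by
      filter_upwards [isOpen_compl_singleton.mem_nhds hx] with y hy
      exact h y hy
    rw [this.fderiv_eq]
    simp
  have h3 := (Λ.hasFDerivAt.comp x hd.hasFDerivAt).fderiv
  have h4 := congrArg (fun L : V →L[ℝ] U => L v) (h3.symm.trans h2)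
  rw [h1]
  simpa using h4

end IsSmoothHomogeneous

/-! ### The Cauchy–Riemann operators in terms of the total derivative -/

/-- Right multiplication by a Clifford number. -/
noncomputable def mulRightCLM {m : ℕ} (a : Cl m) : Cl m →L[ℝ] Cl m :=
  LinearMap.toContinuousLinearMap (LinearMap.mulRight ℝ a)

@[simp]
theorem mulLeftCLM_apply {m : ℕ} (a b : Cl m) : mulLeftCLM a b = a * b := rfl

@[simp]
theorem mulRightCLM_apply {m : ℕ} (a b : Cl m) : mulRightCLM a b = b * a := rfl

/-- The vector embedding as a continuous linear map. -/
noncomputable def vecCLM (m : ℕ) : Full m →L[ℝ] Cl m :=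
  LinearMap.toContinuousLinearMap (CliffordAlgebra.ι (negForm m))

@[simp]
theorem vecCLM_apply {m : ℕ} (x : Full m) : vecCLM m x = vec x := rfl

theorem vec_mul_vec {m : ℕ} (x : Full m) : vec x * vec x = (-‖x‖ ^ 2) • (1 : Cl m) := by
  rw [vec, CliffordAlgebra.ι_sq_scalar, negForm_apply, Algebra.algebraMap_eq_smul_one]

theorem e_mul_self {m : ℕ} (i : Fin (m + 1)) : (e i : Cl m) * e i = -1 := by
  rw [e, vec_mul_vec]
  simp

theorem e0bar_mul_e_zero (m : ℕ) : e0bar m * e 0 = 1 := by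
  rw [e0bar_eq, neg_mul, e_mul_self, neg_neg]

theorem e_zero_mul_e0bar (m : ℕ) : e 0 * e0bar m = 1 := by
  rw [e0bar_eq, mul_neg, e_mul_self, neg_neg]

theorem e0bar_mul_self (m : ℕ) : e0bar m * e0bar m = -1 := by
  rw [e0bar_eq, neg_mul_neg, e_mul_self]

theorem vec_eq_sum {m : ℕ} (x : Full m) : vec x = ∑ i, x i • e i := by
  have h : x = ∑ i, x i • EuclideanSpace.single i (1 : ℝ) := by
    ext j
    simp [Finset.sum_apply, Pi.single_apply]
  conv_lhs => rw [h]
  simp only [← vecCLM_apply, map_sum, map_smul, e]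

theorem e0bar_mul_e_succ {m : ℕ} (j : Fin m) : e0bar m * e j.succ = -(e j.succ * e0bar m) := by
  have h : (e 0 : Cl m) * e j.succ = -(e j.succ * e 0) := by
    unfold e vec
    refine CliffordAlgebra.ι_mul_ι_comm_of_isOrtho ?_
    rw [QuadraticMap.isOrtho_def]
    simp only [negForm_apply]
    rw [@norm_add_sq_real]
    simp [EuclideanSpace.inner_single_left]
  rw [e0bar_eq, neg_mul, h, mul_neg]

/-- The left Cauchy–Riemann operator, as a linear function of the derivative. -/
noncomputable def crLeftCLM (m : ℕ) : (Full m →L[ℝ] Cl m) →L[ℝ] Cl m :=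
  (1 / 2 : ℝ) • mulLeftCLM (e0bar m) ∘L ∑ i, mulLeftCLM (e i) ∘L
    ContinuousLinearMap.apply ℝ (Cl m) (EuclideanSpace.single i (1 : ℝ) : Full m)

/-- The right Cauchy–Riemann operator, as a linear function of the derivative. -/
noncomputable def crRightCLM (m : ℕ) : (Full m →L[ℝ] Cl m) →L[ℝ] Cl m :=
  (1 / 2 : ℝ) • ∑ i, mulRightCLM (e0bar m * e i) ∘L
    ContinuousLinearMap.apply ℝ (Cl m) (EuclideanSpace.single i (1 : ℝ) : Full m)

theorem crLeftCLM_apply {m : ℕ} (A : Full m →L[ℝ] Cl m) : crLeftCLM m A =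
    (1 / 2 : ℝ) • (e0bar m * ∑ i, e i * A (EuclideanSpace.single i (1 : ℝ))) := by
  simp [crLeftCLM, Finset.mul_sum]

theorem crRightCLM_apply {m : ℕ} (A : Full m →L[ℝ] Cl m) : crRightCLM m A =
    (1 / 2 : ℝ) • ∑ i, A (EuclideanSpace.single i (1 : ℝ)) * (e0bar m * e i) := by
  simp [crRightCLM]

/-- Since `ē₀ e₀ = 1`, the derivative in `x₀` is the missing term `i = 0` of the sum over all
generators, so no coordinate plays a special role. -/
theorem crLeft_eq {m : ℕ} (F : Full m → Cl m) (x : Full m) :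
    crLeft F x = crLeftCLM m (fderiv ℝ F x) := by
  rw [crLeft, crLeftCLM_apply, Fin.sum_univ_succ, mul_add, ← mul_assoc, e0bar_mul_e_zero, one_mul]
  rfl

theorem crRight_eq {m : ℕ} (F : Full m → Cl m) (x : Full m) :
    crRight F x = crRightCLM m (fderiv ℝ F x) := by
  rw [crRight, crRightCLM_apply, Fin.sum_univ_succ, e0bar_mul_e_zero, mul_one]
  rfl

theorem crRight_mul_left {m : ℕ} (a : Cl m) {F : Full m → Cl m} {x : Full m}
    (hF : DifferentiableAt ℝ F x) : crRight (fun y => a * F y) x = a * crRight F x := by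
  have h : fderiv ℝ (fun y => a * F y) x = mulLeftCLM a ∘L fderiv ℝ F x :=
    ((mulLeftCLM a).hasFDerivAt.comp x hF.hasFDerivAt).fderiv
  rw [crRight_eq, crRight_eq, h]
  simp [crRightCLM_apply, Finset.mul_sum, mul_assoc]

/-- By associativity a constant on the left passes through an operator whose coefficients act from
the right. -/
theorem RightMonogenicOn.mul_left {m : ℕ} {F : Full m → Cl m} {Ω : Set (Full m)} (hΩ : IsOpen Ω)
    (hF : RightMonogenicOn F Ω) (a : Cl m) : RightMonogenicOn (fun x => a * F x) Ω := by
  refine ⟨(mulLeftCLM a).contDiff.comp_contDiffOn hF.1, fun x hx => ?_⟩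
  rw [crRight_mul_left a ((hF.1.contDiffAt (hΩ.mem_nhds hx)).differentiableAt (by simp)),
    hF.2 x hx, mul_zero]

theorem RightMonogenicOn.mono {m : ℕ} {F : Full m → Cl m} {Ω Ω' : Set (Full m)}
    (hF : RightMonogenicOn F Ω) (h : Ω' ⊆ Ω) : RightMonogenicOn F Ω' :=
  ⟨hF.1.mono h, fun x hx => hF.2 x (h hx)⟩

theorem LeftMonogenicOn.mono {m : ℕ} {F : Full m → Cl m} {Ω Ω' : Set (Full m)}
    (hF : LeftMonogenicOn F Ω) (h : Ω' ⊆ Ω) : LeftMonogenicOn F Ω' :=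
  ⟨hF.1.mono h, fun x hx => hF.2 x (h hx)⟩

theorem RightMonogenicOn.neg {m : ℕ} {F : Full m → Cl m} {Ω : Set (Full m)}
    (hF : RightMonogenicOn F Ω) : RightMonogenicOn (fun x => -F x) Ω :=
  ⟨hF.1.neg, fun x hx => by
    rw [crRight_eq, fderiv_fun_neg, map_neg, ← crRight_eq, hF.2 x hx, neg_zero]⟩

theorem LeftMonogenicOn.neg {m : ℕ} {F : Full m → Cl m} {Ω : Set (Full m)}
    (hF : LeftMonogenicOn F Ω) : LeftMonogenicOn (fun x => -F x) Ω :=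
  ⟨hF.1.neg, fun x hx => by
    rw [crLeft_eq, fderiv_fun_neg, map_neg, ← crLeft_eq, hF.2 x hx, neg_zero]⟩

theorem isOpen_upper (m : ℕ) : IsOpen (upper m) :=
  isOpen_lt continuous_const (EuclideanSpace.proj (𝕜 := ℝ) (0 : Fin (m + 1))).continuous

theorem isOpen_lower (m : ℕ) : IsOpen (lower m) :=
  isOpen_lt (EuclideanSpace.proj (𝕜 := ℝ) (0 : Fin (m + 1))).continuous continuous_const

theorem upper_subset (m : ℕ) : upper m ⊆ {0}ᶜ := by
  rintro x hx rfl
  simp [upper] at hx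

theorem lower_subset (m : ℕ) : lower m ⊆ {0}ᶜ := by
  rintro x hx rfl
  simp [lower] at hx

/-! ### Monogenicity of the downstream potentials -/

theorem hasFDerivAt_inv_norm_pow {m n : ℕ} {x : Full m} (hx : x ≠ 0) :
    HasFDerivAt (fun y : Full m => 1 / ‖y‖ ^ n) (-(n * (‖x‖ ^ (n + 2))⁻¹) • innerSL ℝ x) x := by
  have hx' : 0 < ‖x‖ := norm_pos_iff.mpr hx
  have h1 : HasFDerivAt (fun y : Full m => ‖y‖) (‖x‖⁻¹ • innerSL ℝ x) x := by
    have h := (hasStrictFDerivAt_norm_sq x).hasFDerivAt.sqrt (by positivity)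
    simp only [Real.sqrt_sq (norm_nonneg _)] at h
    convert! h using 1
    rw [two_smul, ← two_smul ℝ, smul_smul]
    congr 1
    field_simp
  have h2 : HasDerivAt (fun r : ℝ => 1 / r ^ n) (-(n * (‖x‖ ^ (n + 1))⁻¹)) ‖x‖ := by
    have h := (hasDerivAt_pow n ‖x‖).inv (by positivity)
    simp only [one_div]
    convert! h using 1
    -- The derivative of `r ^ n` contains the truncated exponent `n - 1`, so `n = 0` is treated
    -- apart.
    rcases n with _ | n
    · simp
    · field_simp
      simp
      ring
  have h3 := h2.comp_hasFDerivAt x h1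
  convert! h3 using 1
  rw [smul_smul]
  congr 1
  rw [pow_succ _ (n + 1), mul_inv]
  ring

theorem hasFDerivAt_cauchyKernel {m : ℕ} {x : Full m} (hx : x ≠ 0) :
    HasFDerivAt (cauchyKernel m) ((1 / sphereArea (m + 1)) •
      ((1 / ‖x‖ ^ (m + 1)) • (mulRightCLM (e0bar m) ∘L vecCLM m) +
        (-((m + 1) * (‖x‖ ^ (m + 3))⁻¹) • innerSL ℝ x).smulRight (vec x * e0bar m))) x := by
  have h1 := (hasFDerivAt_inv_norm_pow (n := m + 1) hx).smul
    (mulRightCLM (e0bar m) ∘L vecCLM m).hasFDerivAt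
  have h2 := h1.const_smul (1 / sphereArea (m + 1))
  convert! h2 using 1
  · ext y
    simp [cauchyKernel, smul_smul]
  · simp

/-- Each `e_i e_i = -1` contributes `-ē₀ / |x|^(m+1)`, in total `m + 1` times. Differentiating the
power of the norm gives `-(m+1) x x ē₀ / |x|^(m+3)`, and `x x = -|x|²` makes the two cancel. -/
theorem crLeft_cauchyKernel {m : ℕ} {x : Full m} (hx : x ≠ 0) : crLeft (cauchyKernel m) x = 0 := by
  have hx' : 0 < ‖x‖ := norm_pos_iff.mpr hx
  rw [crLeft_eq, (hasFDerivAt_cauchyKernel hx).fderiv, map_smul, crLeftCLM_apply]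
  have h : ∑ i, (e i : Cl m) * ((1 / ‖x‖ ^ (m + 1)) • (mulRightCLM (e0bar m) ∘L vecCLM m) +
        (-((m + 1) * (‖x‖ ^ (m + 3))⁻¹) • innerSL ℝ x).smulRight (vec x * e0bar m))
          (EuclideanSpace.single i (1 : ℝ)) = 0 := by
    have h1 : ∀ i, (e i : Cl m) * ((1 / ‖x‖ ^ (m + 1)) • (mulRightCLM (e0bar m) ∘L vecCLM m) +
        (-((m + 1) * (‖x‖ ^ (m + 3))⁻¹) • innerSL ℝ x).smulRight (vec x * e0bar m))
          (EuclideanSpace.single i (1 : ℝ)) = -(1 / ‖x‖ ^ (m + 1)) • e0bar m +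
            (-((m + 1) * (‖x‖ ^ (m + 3))⁻¹)) • ((x i • e i) * (vec x * e0bar m)) := by
      intro i
      simp only [_root_.add_apply, _root_.smul_apply, ContinuousLinearMap.comp_apply,
        vecCLM_apply, mulRightCLM_apply, ContinuousLinearMap.smulRight_apply, innerSL_apply_apply,
        EuclideanSpace.inner_single_right, mul_add, mul_smul_comm, smul_mul_assoc]
      congr 1
      · rw [show vec (EuclideanSpace.single i (1 : ℝ)) = (e i : Cl m) from rfl, ← mul_assoc,
          e_mul_self]
        simp
      · simp only [smul_smul]
        congr 1
        simp
    rw [Finset.sum_congr rfl fun i _ => h1 i, Finset.sum_add_distrib, ← Finset.smul_sum,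
      ← Finset.smul_sum, ← Finset.sum_mul, ← vec_eq_sum, ← mul_assoc, vec_mul_vec]
    simp only [Finset.sum_const, Finset.card_univ, Fintype.card_fin, smul_mul_assoc, one_mul,
      smul_smul, ← Nat.cast_smul_eq_nsmul ℝ, ← add_smul]
    convert zero_smul ℝ _
    push_cast
    field_simp
    ring
  rw [h]
  simp

theorem crRight_cauchyKernel {m : ℕ} {x : Full m} (hx : x ≠ 0) :
    crRight (cauchyKernel m) x = 0 := by
  have hx' : 0 < ‖x‖ := norm_pos_iff.mpr hx
  rw [crRight_eq, (hasFDerivAt_cauchyKernel hx).fderiv, map_smul, crRightCLM_apply]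
  have h : ∑ i, ((1 / ‖x‖ ^ (m + 1)) • (mulRightCLM (e0bar m) ∘L vecCLM m) +
        (-((m + 1) * (‖x‖ ^ (m + 3))⁻¹) • innerSL ℝ x).smulRight (vec x * e0bar m))
          (EuclideanSpace.single i (1 : ℝ)) * (e0bar m * e i : Cl m) = 0 := by
    have h1 : ∀ i, ((1 / ‖x‖ ^ (m + 1)) • (mulRightCLM (e0bar m) ∘L vecCLM m) +
        (-((m + 1) * (‖x‖ ^ (m + 3))⁻¹) • innerSL ℝ x).smulRight (vec x * e0bar m))
          (EuclideanSpace.single i (1 : ℝ)) * (e0bar m * e i : Cl m) =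
          (1 / ‖x‖ ^ (m + 1)) • (1 : Cl m) +
            ((m + 1) * (‖x‖ ^ (m + 3))⁻¹) • (vec x * (x i • e i)) := by
      intro i
      -- The two inner factors `ē₀` meet and give `-1`, after which the cancellation is the one of
      -- the left-hand case.
      have h2 : ∀ a : Cl m, a * e0bar m * (e0bar m * e i) = -(a * e i) := by
        intro a
        rw [mul_assoc, ← mul_assoc (e0bar m), e0bar_mul_self]
        simp
      simp only [_root_.add_apply, _root_.smul_apply, ContinuousLinearMap.comp_apply,
        vecCLM_apply, mulRightCLM_apply, ContinuousLinearMap.smulRight_apply, innerSL_apply_apply,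
        EuclideanSpace.inner_single_right, add_mul, mul_smul_comm, smul_mul_assoc, h2]
      congr 1
      · rw [show vec (EuclideanSpace.single i (1 : ℝ)) = (e i : Cl m) from rfl, e_mul_self]
        simp
      · simp only [smul_neg, ← neg_smul, smul_smul]
        congr 1
        simp
    rw [Finset.sum_congr rfl fun i _ => h1 i, Finset.sum_add_distrib, ← Finset.smul_sum,
      ← Finset.smul_sum, ← Finset.mul_sum, ← vec_eq_sum, vec_mul_vec]
    simp only [Finset.sum_const, Finset.card_univ, Fintype.card_fin,
      smul_smul, ← Nat.cast_smul_eq_nsmul ℝ, ← add_smul]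
    convert zero_smul ℝ _
    push_cast
    field_simp
    ring
  rw [h]
  simp

theorem isSmoothHomogeneous_cauchyKernel (m : ℕ) : IsSmoothHomogeneous m (cauchyKernel m) where
  contDiffOn := by
    have h1 : ContDiffOn ℝ (⊤ : ℕ∞) (fun x : Full m => 1 / sphereArea (m + 1) * (1 / ‖x‖ ^ (m + 1)))
        {0}ᶜ := by
      intro x hx
      have hx' : ‖x‖ ^ (m + 1) ≠ 0 := pow_ne_zero _ (norm_ne_zero_iff.mpr hx)
      exact (contDiffAt_const.mul
        (contDiffAt_const.div ((contDiffAt_norm ℝ hx).pow _) hx')).contDiffWithinAt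
    exact h1.smul (mulRightCLM (e0bar m) ∘L vecCLM m).contDiff.contDiffOn
  map_smul t ht x hx := by
    have h : vec (t • x) = t • (vec x : Cl m) := (vecCLM m).map_smul t x
    simp only [cauchyKernel, h, norm_smul, Real.norm_of_nonneg ht.le, smul_mul_assoc, smul_smul]
    congr 1
    have hx' : ‖x‖ ≠ 0 := norm_ne_zero_iff.mpr hx
    rw [mul_pow]
    field_simp
    ring

theorem crConj_eq_partialD {m : ℕ} {F : Full m → Cl m} {x : Full m} (h : crLeft F x = 0) :
    crConj F x = partialD 0 F x := by
  have h1 : crConj F x = partialD 0 F x - crLeft F x := by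
    rw [crConj, crLeft, smul_sub, smul_add, sub_eq_sub_iff_add_eq_add]
    abel_nf
    rw [← smul_assoc]
    norm_num
    abel
  rw [h1, h, sub_zero]

theorem potential_succ (m k : ℕ) : potential m (k + 1) = crConj (potential m k) :=
  Function.iterate_succ_apply' _ _ _

theorem potential_properties (m k : ℕ) : IsSmoothHomogeneous (m + k) (potential m k) ∧
    (∀ x, x ≠ 0 → crLeft (potential m k) x = 0) ∧
    ∀ x, x ≠ 0 → crRight (potential m k) x = 0 := by
  induction k with
  | zero =>
    exact ⟨isSmoothHomogeneous_cauchyKernel m, fun x hx => crLeft_cauchyKernel hx,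
      fun x hx => crRight_cauchyKernel hx⟩
  | succ k ih =>
    obtain ⟨hS, hL, hR⟩ := ih
    have heq : ∀ x, x ≠ 0 → potential m (k + 1) x =
        fderiv ℝ (potential m k) x (EuclideanSpace.single 0 1) := fun x hx => by
      rw [potential_succ, crConj_eq_partialD (hL x hx)]
      rfl
    -- The identity `heq` holds on a neighbourhood of each nonzero point, so it may be
    -- differentiated.
    have hfd : ∀ x, x ≠ 0 → fderiv ℝ (potential m (k + 1)) x =
        fderiv ℝ (fun y => fderiv ℝ (potential m k) y (EuclideanSpace.single 0 1)) x := by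
      intro x hx
      refine Filter.EventuallyEq.fderiv_eq ?_
      filter_upwards [isOpen_compl_singleton.mem_nhds hx] with y hy
      exact heq y hy
    refine ⟨(hS.fderiv_apply _).congr heq, fun x hx => ?_, fun x hx => ?_⟩
    · rw [crLeft_eq, hfd x hx]
      exact hS.map_fderiv_fderiv_eq_zero _ (fun y hy => by rw [← crLeft_eq, hL y hy]) _ hx
    · rw [crRight_eq, hfd x hx]
      exact hS.map_fderiv_fderiv_eq_zero _ (fun y hy => by rw [← crRight_eq, hR y hy]) _ hx

theorem isSmoothHomogeneous_potential (m k : ℕ) : IsSmoothHomogeneous (m + k) (potential m k) :=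
  (potential_properties m k).1

theorem leftMonogenicOn_potential (m k : ℕ) : LeftMonogenicOn (potential m k) {0}ᶜ :=
  ⟨(isSmoothHomogeneous_potential m k).contDiffOn.of_le (by norm_cast),
    (potential_properties m k).2.1⟩

theorem rightMonogenicOn_potential (m k : ℕ) : RightMonogenicOn (potential m k) {0}ᶜ :=
  ⟨(isSmoothHomogeneous_potential m k).contDiffOn.of_le (by norm_cast),
    (potential_properties m k).2.2⟩

/-! ### Points of the horizontal hyperplanes -/

/-- The inclusion of `ℝ^m` into `ℝ^(m+1)`, as a continuous linear map. -/
noncomputable def pointCLM (m : ℕ) : Base m →L[ℝ] Full m :=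
  LinearMap.toContinuousLinearMap
    { toFun := point 0
      map_add' := fun x y => by simpa using point_add (0 : ℝ) 0 x y
      map_smul' := fun c x => by simpa using point_smul c (0 : ℝ) x }

@[simp]
theorem pointCLM_apply {m : ℕ} (x : Base m) : pointCLM m x = point 0 x := rfl

theorem pointCLM_single {m : ℕ} (j : Fin m) :
    pointCLM m (EuclideanSpace.single j 1) = EuclideanSpace.single j.succ 1 := by
  ext i
  refine Fin.cases ?_ (fun k => ?_) i
  · simp [point, (Fin.succ_ne_zero j).symm]
  · simp [point, Pi.single_apply]

theorem point_eq_add {m : ℕ} (a : ℝ) (x : Base m) : point a x = point a 0 + pointCLM m x := by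
  simpa using point_add a 0 0 x

theorem hasFDerivAt_point {m : ℕ} (a : ℝ) (x : Base m) :
    HasFDerivAt (point a : Base m → Full m) (pointCLM m) x := by
  have h : (point a : Base m → Full m) = fun x => point a 0 + pointCLM m x :=
    funext (point_eq_add a)
  rw [h]
  exact (pointCLM m).hasFDerivAt.const_add _

theorem continuous_point {m : ℕ} (a : ℝ) : Continuous (point a : Base m → Full m) :=
  continuous_iff_continuousAt.mpr fun x => (hasFDerivAt_point a x).continuousAt

theorem norm_point_sq {m : ℕ} (a : ℝ) (x : Base m) : ‖point a x‖ ^ 2 = a ^ 2 + ‖x‖ ^ 2 := by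
  rw [EuclideanSpace.norm_sq_eq, EuclideanSpace.norm_sq_eq, Fin.sum_univ_succ]
  simp [point]

theorem norm_point_eq_sqrt {m : ℕ} (a : ℝ) (x : Base m) :
    ‖point a x‖ = √(a ^ 2 + ‖x‖ ^ 2) := by
  rw [← norm_point_sq, Real.sqrt_sq (norm_nonneg _)]

theorem abs_le_norm_point {m : ℕ} (a : ℝ) (x : Base m) : |a| ≤ ‖point a x‖ := by
  rw [norm_point_eq_sqrt]
  exact Real.abs_le_sqrt (by nlinarith [sq_nonneg ‖x‖])

theorem norm_le_norm_point {m : ℕ} (a : ℝ) (x : Base m) : ‖x‖ ≤ ‖point a x‖ := by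
  rw [norm_point_eq_sqrt]
  exact Real.le_sqrt_of_sq_le (by nlinarith [sq_nonneg a])

theorem point_ne_zero {m : ℕ} {a : ℝ} (ha : a ≠ 0) (x : Base m) : point a x ≠ 0 :=
  norm_pos_iff.mp ((abs_pos.mpr ha).trans_le (abs_le_norm_point a x))

/-! ### Boundary values of derivatives -/

/-- A plane at height `a ≠ 0` stays at distance `|a|` from the origin, where `F` is bounded; the
test function supplies the decay. -/
theorem IsSmoothHomogeneous.integrable_smul_point {m n : ℕ} {F : Full m → Cl m}
    (hF : IsSmoothHomogeneous n F) (φ : 𝓢(Base m, ℝ)) {a : ℝ} (ha : a ≠ 0) :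
    Integrable fun x : Base m => φ x • F (point a x) := by
  obtain ⟨B, hB⟩ := hF.exists_norm_le (abs_pos.mpr ha)
  have hc : Continuous fun x : Base m => F (point a x) :=
    continuous_iff_continuousAt.mpr fun x =>
      (hF.contDiffAt (point_ne_zero ha x)).continuousAt.comp (continuous_point a).continuousAt
  refine Integrable.mono' (φ.integrable.norm.mul_const B)
    (φ.continuous.smul hc).aestronglyMeasurable (ae_of_all _ fun x => ?_)
  rw [norm_smul]
  exact mul_le_mul_of_nonneg_left (hB _ (abs_le_norm_point a x)) (norm_nonneg _)

/-- The equation `D F = 0` trades the normal derivative for the tangential `-ē₀ ∂ F`, whose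
derivatives can be moved onto the test function. The limit then only involves the known boundary
value of `F`. -/
theorem HasBoundaryValue.of_partialD {m n : ℕ} {l : Filter ℝ} (hl : ∀ᶠ a in l, a ≠ 0)
    {F G : Full m → Cl m} (hF : IsSmoothHomogeneous n F) (hL : ∀ x, x ≠ 0 → crLeft F x = 0)
    (hG : ∀ x, x ≠ 0 → G x = partialD 0 F x) {T : Distr m} (hT : HasBoundaryValue l F T) :
    HasBoundaryValue l G (-(mulLeftCLM (e0bar m) ∘L dirac T)) := by
  intro φ
  have hGS : IsSmoothHomogeneous (n + 1) G := (hF.fderiv_apply _).congr hG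
  refine ⟨hl.mono fun a ha => hGS.integrable_smul_point φ ha, ?_⟩
  have hlim : Tendsto (fun a : ℝ => e0bar m * ∑ j : Fin m, e j.succ *
      ∫ x : Base m, (LineDeriv.lineDerivOp (EuclideanSpace.single j (1 : ℝ)) φ) x •
        F (point a x)) l
      (𝓝 (e0bar m * ∑ j : Fin m, e j.succ *
        T (LineDeriv.lineDerivOp (EuclideanSpace.single j (1 : ℝ)) φ))) := by
    refine ((mulLeftCLM (e0bar m)).continuous.tendsto _).comp ?_
    refine tendsto_finsetSum _ fun j _ => ?_
    exact ((mulLeftCLM (e j.succ)).continuous.tendsto _).comp (hT _).2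
  have hval : (-(mulLeftCLM (e0bar m) ∘L dirac T)) φ = e0bar m * ∑ j : Fin m, e j.succ *
        T (LineDeriv.lineDerivOp (EuclideanSpace.single j (1 : ℝ)) φ) := by
    simp [dirac_apply]
  rw [hval]
  refine hlim.congr' (hl.mono fun a ha => ?_)
  have hd : ∀ x : Base m, HasFDerivAt (fun y : Base m => F (point a y))
      (fderiv ℝ F (point a x) ∘L pointCLM m) x := fun x =>
    (hF.differentiableAt (point_ne_zero ha x)).hasFDerivAt.comp x (hasFDerivAt_point a x)
  have hfd : ∀ (x : Base m) (j : Fin m), fderiv ℝ (fun y : Base m => F (point a y)) x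
      (EuclideanSpace.single j 1) = partialD j.succ F (point a x) := by
    intro x j
    rw [(hd x).fderiv, ContinuousLinearMap.comp_apply, pointCLM_single]
    rfl
  have hI : ∀ j : Fin m, Integrable fun x : Base m => φ x • partialD j.succ F (point a x) :=
    fun j => (hF.fderiv_apply (EuclideanSpace.single j.succ 1)).integrable_smul_point φ ha
  -- Integration by parts leaves no boundary terms: all products involved are integrable on the
  -- whole plane.
  have hparts : ∀ j : Fin m,
      ∫ x : Base m, (LineDeriv.lineDerivOp (EuclideanSpace.single j (1 : ℝ)) φ) x •
        F (point a x) = -∫ x : Base m, φ x • partialD j.succ F (point a x) := by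
    intro j
    have h := integral_smul_fderiv_eq_neg_fderiv_smul_of_integrable (μ := volume)
      (f := φ) (g := fun y : Base m => F (point a y)) (v := EuclideanSpace.single j (1 : ℝ))
      (hF.integrable_smul_point (LineDeriv.lineDerivOp (EuclideanSpace.single j (1 : ℝ)) φ) ha)
      (by simpa only [hfd] using hI j) (hF.integrable_smul_point φ ha)
      (fun x _ => φ.differentiableAt) (fun x _ => (hd x).differentiableAt)
    simp only [hfd] at h
    rw [h, neg_neg]
    rfl
  have hpt : ∀ x : Base m, φ x • G (point a x) =
      -mulLeftCLM (e0bar m) (∑ j : Fin m, mulLeftCLM (e j.succ)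
        (φ x • partialD j.succ F (point a x))) := by
    intro x
    have h0 := hL _ (point_ne_zero ha x)
    -- The equation `D F = 0` is solved for the derivative in `x₀`.
    rw [crLeft, smul_eq_zero, or_iff_right (by norm_num), add_eq_zero_iff_eq_neg] at h0
    rw [hG _ (point_ne_zero ha x), h0]
    simp [Finset.mul_sum, Finset.smul_sum]
  simp only [hpt, hparts]
  rw [integral_neg, ContinuousLinearMap.integral_comp_comm _
    (integrable_finsetSum _ fun j _ => (mulLeftCLM (e j.succ)).integrable_comp (hI j)),
    integral_finsetSum _ fun j _ => (mulLeftCLM (e j.succ)).integrable_comp (hI j)]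
  simp only [ContinuousLinearMap.integral_comp_comm _ (hI _)]
  simp [Finset.mul_sum]

theorem HasBoundaryValue.mul_left {m : ℕ} {l : Filter ℝ} {F : Full m → Cl m} {T : Distr m}
    (hT : HasBoundaryValue l F T) (a : Cl m) :
    HasBoundaryValue l (fun x => a * F x) (mulLeftCLM a ∘L T) := by
  intro φ
  have h : ∀ x₀ (x : Base m), φ x • (a * F (point x₀ x)) = mulLeftCLM a (φ x • F (point x₀ x)) := by
    intro x₀ x
    simp
  simp only [h]
  refine ⟨(hT φ).1.mono fun x₀ hx => (mulLeftCLM a).integrable_comp hx, ?_⟩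
  refine (((mulLeftCLM a).continuous.tendsto _).comp (hT φ).2).congr' ?_
  exact (hT φ).1.mono fun x₀ hx => ((mulLeftCLM a).integral_comp_comm hx).symm

theorem HasBoundaryValue.neg {m : ℕ} {l : Filter ℝ} {F : Full m → Cl m} {T : Distr m}
    (hT : HasBoundaryValue l F T) : HasBoundaryValue l (fun x => -F x) (-T) := by
  intro φ
  simp only [smul_neg, integral_neg]
  exact ⟨(hT φ).1.mono fun x₀ hx => hx.neg, (hT φ).2.neg⟩

/-! ### The total mass of the Poisson kernel -/

/-- Multiplied by `Γ(s)`, the integrand becomes `∫ t^(s-1) exp(-(1+|y|²)t) dt` over `t > 0`. After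
exchanging the integrals, the one over `y` is Gaussian, and what remains is the integral of `Γ(s -
d)`. -/
theorem integral_one_add_norm_sq_rpow {V : Type*} [NormedAddCommGroup V] [InnerProductSpace ℝ V]
    [FiniteDimensional ℝ V] [MeasurableSpace V] [BorelSpace V] {s : ℝ}
    (hs : (Module.finrank ℝ V : ℝ) / 2 < s) :
    ∫ y : V, (1 / (1 + ‖y‖ ^ 2)) ^ s =
      π ^ ((Module.finrank ℝ V : ℝ) / 2) * Real.Gamma (s - Module.finrank ℝ V / 2) /
        Real.Gamma s := by
  set d : ℝ := (Module.finrank ℝ V : ℝ) / 2 with hd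
  have hd0 : 0 ≤ d := by positivity
  have hs0 : 0 < s := hd0.trans_lt hs
  have h1 : ∀ y : V, (1 / (1 + ‖y‖ ^ 2)) ^ s * Real.Gamma s =
      ∫ t in Ioi (0 : ℝ), t ^ (s - 1) * rexp (-((1 + ‖y‖ ^ 2) * t)) := fun y =>
    (Real.integral_rpow_mul_exp_neg_mul_Ioi hs0 (by positivity)).symm
  have hgauss : ∀ t : ℝ, 0 < t → (∫ y : V, t ^ (s - 1) * rexp (-((1 + ‖y‖ ^ 2) * t))) =
      π ^ d * (rexp (-t) * t ^ (s - d - 1)) := by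
    intro t ht
    have h2 : ∀ y : V, t ^ (s - 1) * rexp (-((1 + ‖y‖ ^ 2) * t)) =
        t ^ (s - 1) * rexp (-t) * rexp (-t * ‖y‖ ^ 2) := by
      intro y
      rw [mul_assoc, ← Real.exp_add]
      congr 2
      ring
    simp only [h2]
    rw [integral_const_mul, GaussianFourier.integral_rexp_neg_mul_sq_norm ht, ← hd,
      Real.div_rpow Real.pi_pos.le ht.le, show s - d - 1 = (s - 1) - d by ring,
      Real.rpow_sub ht (s - 1) d]
    ring
  have hint : Integrable (Function.uncurry fun (y : V) (t : ℝ) =>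
      t ^ (s - 1) * rexp (-((1 + ‖y‖ ^ 2) * t)))
      ((volume : Measure V).prod (volume.restrict (Ioi (0 : ℝ)))) := by
    have hmeas : Measurable (Function.uncurry fun (y : V) (t : ℝ) =>
        t ^ (s - 1) * rexp (-((1 + ‖y‖ ^ 2) * t))) := by
      unfold Function.uncurry
      fun_prop
    rw [integrable_prod_iff' hmeas.aestronglyMeasurable]
    constructor
    · refine (ae_restrict_iff' measurableSet_Ioi).mpr (ae_of_all _ fun t ht => ?_)
      -- A non-integrable function has integral `0` by convention, whereas the Gaussian value is
      -- strictly positive.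
      by_contra hcon
      change ¬Integrable fun y : V => t ^ (s - 1) * rexp (-((1 + ‖y‖ ^ 2) * t)) at hcon
      have h3 := hgauss t ht
      rw [integral_undef hcon] at h3
      have ht' : (0 : ℝ) < t := ht
      have : 0 < π ^ d * (rexp (-t) * t ^ (s - d - 1)) := by positivity
      exact this.ne h3
    · refine ((Real.GammaIntegral_convergent (s := s - d) (by linarith)).const_mul
        (π ^ d)).congr ?_
      refine (ae_restrict_iff' measurableSet_Ioi).mpr (ae_of_all _ fun t ht => ?_)
      have ht' : (0 : ℝ) < t := ht
      refine (hgauss t ht).symm.trans (integral_congr_ae (ae_of_all _ fun y => ?_))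
      beta_reduce
      rw [Function.uncurry_apply_pair, Real.norm_of_nonneg (by positivity)]
  have h4 := integral_integral_swap hint
  simp only [← h1] at h4
  rw [integral_mul_const, setIntegral_congr_fun measurableSet_Ioi (fun t ht => hgauss t ht),
    integral_const_mul, ← Real.Gamma_eq_integral (by linarith)] at h4
  rw [eq_div_iff (Real.Gamma_pos_of_pos hs0).ne', h4]

theorem one_div_norm_point_pow {m : ℕ} (y : Base m) (n : ℕ) :
    1 / ‖point 1 y‖ ^ n = (1 / (1 + ‖y‖ ^ 2)) ^ ((n : ℝ) / 2) := by
  rw [norm_point_eq_sqrt, one_pow, Real.sqrt_eq_rpow, ← Real.rpow_natCast, ← Real.rpow_mul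
    (by positivity), Real.div_rpow zero_le_one (by positivity), Real.one_rpow]
  congr 2
  ring

theorem sphereArea_pos (n : ℕ) (hn : 0 < n) : 0 < sphereArea n := by
  have := Real.Gamma_pos_of_pos (s := (n : ℝ) / 2) (by positivity)
  unfold sphereArea
  positivity

/-- With `s = (m+1)/2` the numerator contains `Γ(1/2) = √π`, which raises `π^(m/2)` to
`π^((m+1)/2)`. -/
theorem integral_poisson (m : ℕ) :
    ∫ y : Base m, 1 / ‖point 1 y‖ ^ (m + 1) = sphereArea (m + 1) / 2 := by
  simp only [one_div_norm_point_pow]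
  rw [integral_one_add_norm_sq_rpow (by simp; linarith)]
  have h : ((m + 1 : ℕ) : ℝ) / 2 - (m : ℝ) / 2 = 1 / 2 := by push_cast; ring
  simp only [finrank_euclideanSpace, Fintype.card_fin]
  rw [h, Real.Gamma_one_half_eq, Real.sqrt_eq_rpow, ← Real.rpow_add Real.pi_pos, sphereArea,
    show (m : ℝ) / 2 + 1 / 2 = ((m + 1 : ℕ) : ℝ) / 2 by push_cast; ring]
  ring

theorem integrable_poisson (m : ℕ) :
    Integrable fun y : Base m => 1 / ‖point 1 y‖ ^ (m + 1) := by
  by_contra h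
  have h1 := integral_poisson m
  rw [integral_undef h] at h1
  have := sphereArea_pos (m + 1) m.succ_pos
  linarith

/-! ### Boundary values of the Cauchy kernel -/

/-- The substitution `x = a y` moves the dependence on `a` into the test function: the Jacobian
`a^m` cancels the homogeneity of the kernel. -/
theorem integral_smul_poisson {m : ℕ} (φ : 𝓢(Base m, ℝ)) {a : ℝ} (ha : 0 < a) :
    ∫ x : Base m, φ x * (a / ‖point a x‖ ^ (m + 1)) =
      ∫ y : Base m, φ (a • y) * (1 / ‖point 1 y‖ ^ (m + 1)) := by
  have h := Measure.integral_comp_smul (volume : Measure (Base m))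
    (fun x => φ x * (a / ‖point a x‖ ^ (m + 1))) a
  have h1 : ∀ y : Base m, φ (a • y) * (a / ‖point a (a • y)‖ ^ (m + 1)) =
      (a ^ m)⁻¹ * (φ (a • y) * (1 / ‖point 1 y‖ ^ (m + 1))) := by
    intro y
    have h2 : point a (a • y) = a • point 1 y := by simpa using point_smul a 1 y
    have h3 : 0 < ‖point 1 y‖ := norm_pos_iff.mpr (point_ne_zero one_ne_zero y)
    rw [h2, norm_smul, Real.norm_of_nonneg ha.le, mul_pow]
    field_simp
    ring
  simp only [h1, integral_const_mul, finrank_euclideanSpace, Fintype.card_fin, smul_eq_mul] at h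
  rw [abs_of_pos (by positivity)] at h
  exact (mul_left_cancel₀ (by positivity) h).symm

theorem tendsto_integral_poisson {m : ℕ} (φ : 𝓢(Base m, ℝ)) :
    Tendsto (fun a : ℝ => ∫ x : Base m, φ x * (a / ‖point a x‖ ^ (m + 1))) (𝓝[>] 0)
      (𝓝 (sphereArea (m + 1) / 2 * φ 0)) := by
  have h : Tendsto (fun a : ℝ => ∫ y : Base m, φ (a • y) * (1 / ‖point 1 y‖ ^ (m + 1)))
      (𝓝[>] 0) (𝓝 (∫ y : Base m, φ 0 * (1 / ‖point 1 y‖ ^ (m + 1)))) := by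
    refine tendsto_integral_filter_of_dominated_convergence
      (fun y => SchwartzMap.seminorm ℝ 0 0 φ * (1 / ‖point 1 y‖ ^ (m + 1))) ?_ ?_
      ((integrable_poisson m).const_mul _) ?_
    · refine Eventually.of_forall fun a => ?_
      have : Continuous fun y : Base m => φ (a • y) := φ.continuous.comp (continuous_const_smul a)
      exact this.aestronglyMeasurable.mul (integrable_poisson m).aestronglyMeasurable
    · refine Eventually.of_forall fun a => ae_of_all _ fun y => ?_
      rw [norm_mul, Real.norm_of_nonneg (r := 1 / ‖point 1 y‖ ^ (m + 1)) (by positivity)]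
      exact mul_le_mul_of_nonneg_right (SchwartzMap.norm_le_seminorm ℝ φ _) (by positivity)
    · refine ae_of_all _ fun y => Tendsto.mul_const _ ?_
      have h1 : Continuous fun a : ℝ => φ (a • y) := φ.continuous.comp (by fun_prop)
      have h2 := h1.tendsto 0
      rw [zero_smul] at h2
      exact h2.mono_left nhdsWithin_le_nhds
  rw [integral_const_mul, integral_poisson, mul_comm] at h
  refine h.congr' ?_
  filter_upwards [self_mem_nhdsWithin] with a ha
  rw [integral_smul_poisson φ ha]

theorem tendsto_integral_poisson_neg {m : ℕ} (φ : 𝓢(Base m, ℝ)) :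
    Tendsto (fun a : ℝ => ∫ x : Base m, φ x * (a / ‖point a x‖ ^ (m + 1))) (𝓝[<] 0)
      (𝓝 (-(sphereArea (m + 1) / 2 * φ 0))) := by
  -- The Poisson kernel is odd in `a`, so the limit from below is minus the limit from above.
  have hneg : Tendsto (fun a : ℝ => -a) (𝓝[<] 0) (𝓝[>] 0) := by
    simpa using tendsto_neg_nhdsLT (a := (0 : ℝ))
  refine ((tendsto_integral_poisson φ).comp hneg).neg.congr fun a => ?_
  rw [Function.comp_apply, ← integral_neg]
  congr 1
  ext x
  rw [norm_point_eq_sqrt, norm_point_eq_sqrt, neg_sq]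
  ring

/-- The kernel is odd, so only the odd part of `φ` contributes to the truncated integrals. That part
vanishes at `0`, which makes the limit an absolutely convergent integral. -/
theorem hilbertKernel_apply {m : ℕ} [NeZero m] (φ : 𝓢(Base m, ℝ)) :
    hilbertKernel m φ = ∫ x, symPart φ x := by
  have hS : ∀ ε : ℝ, MeasurableSet {x : Base m | ε < ‖x‖} := fun ε =>
    measurableSet_lt measurable_const measurable_norm
  have hlim : Tendsto (fun ε : ℝ => ∫ x, {x : Base m | ε < ‖x‖}.indicator (symPart φ) x)
      (𝓝[>] 0) (𝓝 (∫ x, symPart φ x)) := by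
    refine tendsto_integral_filter_of_dominated_convergence (fun x => ‖symPart φ x‖)
      (Eventually.of_forall fun ε => (integrable_symPart φ).aestronglyMeasurable.indicator (hS ε))
      (Eventually.of_forall fun ε => ae_of_all _ fun x => norm_indicator_le_norm_self _ _)
      (integrable_symPart φ).norm (ae_of_all _ fun x => ?_)
    by_cases hx : x = 0
    · have : symPart φ x = 0 := by simp [symPart, hx]
      simp [Set.indicator_apply, this]
    · refine tendsto_const_nhds.congr' ?_
      filter_upwards [mem_nhdsWithin_of_mem_nhds (Iio_mem_nhds (norm_pos_iff.mpr hx))] with ε hε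
      rw [Set.indicator_of_mem]
      exact hε
  refine tendsto_nhds_unique (hilbertKernel_spec m φ) (hlim.congr' ?_)
  filter_upwards [self_mem_nhdsWithin] with ε hε
  rw [integral_truncated φ hε, integral_indicator (hS ε)]

theorem integrable_conjugatePoisson {m : ℕ} (φ : 𝓢(Base m, ℝ)) {a : ℝ} (ha : a ≠ 0) :
    Integrable fun x : Base m => φ x • (1 / ‖point a x‖ ^ (m + 1)) • baseVec x := by
  obtain ⟨C, hC, h⟩ := exists_baseVec_bound m
  have ha' : 0 < |a| := abs_pos.mpr ha
  have hc : Continuous fun x : Base m => 1 / ‖point a x‖ ^ (m + 1) := by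
    refine continuous_const.div ((continuous_point a).norm.pow _) fun x => ?_
    exact pow_ne_zero _ (norm_ne_zero_iff.mpr (point_ne_zero ha x))
  refine Integrable.mono' (φ.integrable.norm.mul_const (C * (|a| ^ m)⁻¹))
    (φ.continuous.smul (hc.smul (continuous_baseVec m))).aestronglyMeasurable
    (ae_of_all _ fun x => ?_)
  have hp : 0 < ‖point a x‖ := norm_pos_iff.mpr (point_ne_zero ha x)
  rw [norm_smul, norm_smul, Real.norm_of_nonneg (r := 1 / _) (by positivity)]
  refine mul_le_mul_of_nonneg_left ?_ (norm_nonneg _)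
  calc 1 / ‖point a x‖ ^ (m + 1) * ‖baseVec x‖
      ≤ 1 / ‖point a x‖ ^ (m + 1) * (C * ‖point a x‖) := by
        have := (h x).trans (mul_le_mul_of_nonneg_left (norm_le_norm_point a x) hC)
        gcongr
    _ = C * (‖point a x‖ ^ m)⁻¹ := by field_simp; ring
    _ ≤ C * (|a| ^ m)⁻¹ := by
        gcongr
        exact abs_le_norm_point a x

/-- Averaging over `x` and `-x` produces the same `symPart φ` as the principal value, up to a factor
bounded uniformly in `a`. This prepares dominated convergence. -/
theorem integral_conjugatePoisson {m : ℕ} (φ : 𝓢(Base m, ℝ)) {a : ℝ} (ha : a ≠ 0) :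
    ∫ x : Base m, φ x • (1 / ‖point a x‖ ^ (m + 1)) • baseVec x =
      ∫ x : Base m, (-(sphereArea (m + 1) / 2) * (‖x‖ / ‖point a x‖) ^ (m + 1)) • symPart φ x := by
  set g : Base m → Cl m := fun x => φ x • (1 / ‖point a x‖ ^ (m + 1)) • baseVec x with hg
  have hI : Integrable g := integrable_conjugatePoisson φ ha
  have hpt : ∀ x, (-(sphereArea (m + 1) / 2) * (‖x‖ / ‖point a x‖) ^ (m + 1)) • symPart φ x =
      (1 / 2 : ℝ) • (g x + g (-x)) := by
    intro x
    have hb : baseVec (-x) = -baseVec x := (baseVecLin m).map_neg x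
    have hn : ‖point a (-x)‖ = ‖point a x‖ := by simp [norm_point_eq_sqrt]
    have hσ := sphereArea_pos (m + 1) m.succ_pos
    simp only [hg, hb, hn, symPart, hilbertFun, smul_neg, smul_smul, ← neg_smul, ← add_smul]
    by_cases hx : x = 0
    · have : baseVec (0 : Base m) = 0 := (baseVecLin m).map_zero
      simp [hx, this]
    · have hx' : 0 < ‖x‖ := norm_pos_iff.mpr hx
      have hp : 0 < ‖point a x‖ := norm_pos_iff.mpr (point_ne_zero ha x)
      congr 1
      rw [div_pow]
      field_simp
      ring
  simp only [hpt]
  rw [integral_smul, integral_add hI hI.comp_neg, integral_neg_eq_self, ← two_smul ℝ, smul_smul]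
  norm_num

theorem tendsto_integral_conjugatePoisson {m : ℕ} [NeZero m] (φ : 𝓢(Base m, ℝ)) :
    Tendsto (fun a : ℝ => ∫ x : Base m, φ x • (1 / ‖point a x‖ ^ (m + 1)) • baseVec x) (𝓝[≠] 0)
      (𝓝 (-(sphereArea (m + 1) / 2) • hilbertKernel m φ)) := by
  have hσ := sphereArea_pos (m + 1) m.succ_pos
  have h : Tendsto (fun a : ℝ => ∫ x : Base m,
      (-(sphereArea (m + 1) / 2) * (‖x‖ / ‖point a x‖) ^ (m + 1)) • symPart φ x) (𝓝[≠] 0)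
      (𝓝 (∫ x : Base m, (-(sphereArea (m + 1) / 2)) • symPart φ x)) := by
    refine tendsto_integral_filter_of_dominated_convergence
      (fun x => sphereArea (m + 1) / 2 * ‖symPart φ x‖) ?_ ?_
      ((integrable_symPart φ).norm.const_mul _) ?_
    · refine Eventually.of_forall fun a => ?_
      have h1 : Measurable fun x : Base m =>
          -(sphereArea (m + 1) / 2) * (‖x‖ / ‖point a x‖) ^ (m + 1) := by
        have := (continuous_point (m := m) a).measurable
        fun_prop
      exact h1.aestronglyMeasurable.smul (integrable_symPart φ).aestronglyMeasurable
    · refine Eventually.of_forall fun a => ae_of_all _ fun x => ?_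
      rw [norm_smul, norm_mul, norm_neg, Real.norm_of_nonneg (r := _ / 2) (by positivity),
        Real.norm_of_nonneg (by positivity)]
      refine mul_le_mul_of_nonneg_right (mul_le_of_le_one_right (by positivity) ?_) (norm_nonneg _)
      exact pow_le_one₀ (by positivity) (div_le_one_of_le₀ (norm_le_norm_point a x) (norm_nonneg _))
    · refine ae_of_all _ fun x => ?_
      -- At the origin the quotient `‖x‖ / ‖point a x‖` does not tend to `1`, but `symPart φ`
      -- vanishes there.
      by_cases hx : x = 0
      · have : symPart φ x = 0 := by simp [symPart, hx]
        simp [this]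
      · have hx' : 0 < ‖x‖ := norm_pos_iff.mpr hx
        have hc : ContinuousAt (fun a : ℝ => (-(sphereArea (m + 1) / 2) *
            (‖x‖ / √(a ^ 2 + ‖x‖ ^ 2)) ^ (m + 1)) • symPart φ x) 0 := by
          have h2 : √((0 : ℝ) ^ 2 + ‖x‖ ^ 2) ≠ 0 := by positivity
          have h3 : ContinuousAt (fun a : ℝ => √(a ^ 2 + ‖x‖ ^ 2)) 0 := by fun_prop
          have h6 : ContinuousAt (fun a : ℝ => ‖x‖ / √(a ^ 2 + ‖x‖ ^ 2)) 0 :=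
            continuousAt_const.div h3 h2
          exact Tendsto.smul_const ((h6.pow (m + 1)).const_mul (-(sphereArea (m + 1) / 2))) _
        have h4 := hc.tendsto
        simp only [← norm_point_eq_sqrt] at h4
        have h5 : ‖point 0 x‖ = ‖x‖ := by simp [norm_point_eq_sqrt]
        rw [h5, div_self hx'.ne', one_pow, mul_one] at h4
        exact h4.mono_left nhdsWithin_le_nhds
  rw [integral_smul, ← hilbertKernel_apply] at h
  refine h.congr' ?_
  filter_upwards [self_mem_nhdsWithin] with a ha
  rw [integral_conjugatePoisson φ ha]

theorem baseVec_mul_e0bar {m : ℕ} (x : Base m) : baseVec x * e0bar m = -(e0bar m * baseVec x) := by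
  have h : baseVec x = ∑ j : Fin m, x j • (e j.succ : Cl m) := by
    rw [baseVec, vec_eq_sum, Fin.sum_univ_succ]
    simp [point]
  rw [h, Finset.sum_mul, Finset.mul_sum, ← Finset.sum_neg_distrib]
  refine Finset.sum_congr rfl fun j _ => ?_
  rw [mul_smul_comm, smul_mul_assoc, e0bar_mul_e_succ, smul_neg, neg_neg]

theorem cauchyKernel_point {m : ℕ} (a : ℝ) (x : Base m) : cauchyKernel m (point a x) =
    (1 / sphereArea (m + 1)) • ((a / ‖point a x‖ ^ (m + 1)) • (1 : Cl m) -
      e0bar m * ((1 / ‖point a x‖ ^ (m + 1)) • baseVec x)) := by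
  have h : vec (point a x) * e0bar m = a • (1 : Cl m) - e0bar m * baseVec x := by
    have h1 : vec (point a x) = a • (e 0 : Cl m) + baseVec x := by
      rw [baseVec, vec_eq_sum, vec_eq_sum, Fin.sum_univ_succ, Fin.sum_univ_succ]
      simp [point]
    rw [h1, add_mul, smul_mul_assoc, e_zero_mul_e0bar, baseVec_mul_e0bar, sub_eq_add_neg]
  rw [cauchyKernel, h, mul_smul, smul_sub, smul_smul, mul_smul_comm]
  congr 3
  ring

/-- The side of approach enters only through the limit of the Poisson part, recorded by `c`, which
is `1/2` from above and `-1/2` from below. The conjugate part has a two-sided limit. -/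
theorem hasBoundaryValue_cauchyKernel {m : ℕ} [NeZero m] {l : Filter ℝ} (hl : l ≤ 𝓝[≠] 0) {c : ℝ}
    (hc : ∀ φ : 𝓢(Base m, ℝ), Tendsto (fun a : ℝ => ∫ x : Base m,
      φ x * (a / ‖point a x‖ ^ (m + 1))) l (𝓝 (sphereArea (m + 1) * c * φ 0))) :
    HasBoundaryValue l (cauchyKernel m)
      (c • delta m + (1 / 2 : ℝ) • (mulLeftCLM (e0bar m) ∘L hilbertKernel m)) := by
  intro φ
  have hσ := sphereArea_pos (m + 1) m.succ_pos
  have hne : ∀ᶠ a in l, a ≠ 0 := hl self_mem_nhdsWithin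
  refine ⟨hne.mono fun a ha =>
    (isSmoothHomogeneous_cauchyKernel m).integrable_smul_point φ ha, ?_⟩
  have hlim : Tendsto (fun a : ℝ => (1 / sphereArea (m + 1)) •
      ((∫ x : Base m, φ x * (a / ‖point a x‖ ^ (m + 1))) • (1 : Cl m) - mulLeftCLM (e0bar m)
        (∫ x : Base m, φ x • (1 / ‖point a x‖ ^ (m + 1)) • baseVec x))) l
      (𝓝 ((1 / sphereArea (m + 1)) • ((sphereArea (m + 1) * c * φ 0) • (1 : Cl m) -
        mulLeftCLM (e0bar m) (-(sphereArea (m + 1) / 2) • hilbertKernel m φ)))) := by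
    refine Tendsto.const_smul (Tendsto.sub ((hc φ).smul_const _) ?_) _
    exact ((mulLeftCLM (e0bar m)).continuous.tendsto _).comp
      ((tendsto_integral_conjugatePoisson φ).mono_left hl)
  have hval : (1 / sphereArea (m + 1)) • ((sphereArea (m + 1) * c * φ 0) • (1 : Cl m) -
        mulLeftCLM (e0bar m) (-(sphereArea (m + 1) / 2) • hilbertKernel m φ)) =
      (c • delta m + (1 / 2 : ℝ) • (mulLeftCLM (e0bar m) ∘L hilbertKernel m)) φ := by
    rw [map_smul, neg_smul, sub_neg_eq_add, smul_add]
    simp only [smul_smul, _root_.add_apply,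
      _root_.smul_apply, ContinuousLinearMap.comp_apply, delta_apply]
    congr 2
    · field_simp
    · field_simp
  rw [← hval]
  refine hlim.congr' (hne.mono fun a ha => ?_)
  have hQ := integrable_conjugatePoisson φ ha
  have hP : Integrable fun x : Base m => φ x * (a / ‖point a x‖ ^ (m + 1)) := by
    have hcont : Continuous fun x : Base m => a / ‖point a x‖ ^ (m + 1) := by
      refine continuous_const.div ((continuous_point a).norm.pow _) fun x => ?_
      exact pow_ne_zero _ (norm_ne_zero_iff.mpr (point_ne_zero ha x))
    have ha' : 0 < |a| := abs_pos.mpr ha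
    refine Integrable.mono' (φ.integrable.norm.mul_const (|a| / |a| ^ (m + 1)))
      (φ.continuous.mul hcont).aestronglyMeasurable (ae_of_all _ fun x => ?_)
    rw [norm_mul, norm_div, norm_pow, norm_norm, Real.norm_eq_abs a]
    gcongr
    exact abs_le_norm_point a x
  have hpt : ∀ x : Base m, φ x • cauchyKernel m (point a x) = (1 / sphereArea (m + 1)) •
      ((φ x * (a / ‖point a x‖ ^ (m + 1))) • (1 : Cl m) - mulLeftCLM (e0bar m)
        (φ x • (1 / ‖point a x‖ ^ (m + 1)) • baseVec x)) := by
    intro x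
    rw [cauchyKernel_point, smul_comm, smul_sub, mul_smul, map_smul, mulLeftCLM_apply]
  simp only [hpt]
  rw [integral_smul, integral_sub (hP.smul_const _) ((mulLeftCLM (e0bar m)).integrable_comp hQ),
    ContinuousLinearMap.integral_comp_comm _ hQ, integral_smul_const]

theorem hasBoundaryValue_cauchyKernel_upper (m : ℕ) [NeZero m] :
    HasBoundaryValue (𝓝[>] 0) (cauchyKernel m)
      ((1 / 2 : ℝ) • delta m + (1 / 2 : ℝ) • (mulLeftCLM (e0bar m) ∘L hilbertKernel m)) := by
  refine hasBoundaryValue_cauchyKernel (nhdsWithin_mono _ fun x hx => ne_of_gt hx) fun φ => ?_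
  convert! tendsto_integral_poisson φ using 2
  ring

theorem hasBoundaryValue_cauchyKernel_lower (m : ℕ) [NeZero m] :
    HasBoundaryValue (𝓝[<] 0) (cauchyKernel m)
      ((-(1 / 2) : ℝ) • delta m + (1 / 2 : ℝ) • (mulLeftCLM (e0bar m) ∘L hilbertKernel m)) := by
  refine hasBoundaryValue_cauchyKernel (nhdsWithin_mono _ fun x hx => ne_of_lt hx) fun φ => ?_
  convert! tendsto_integral_poisson_neg φ using 2
  ring

/-! ### Boundary values of the downstream potentials -/

theorem mulLeftCLM_comp_mulLeftCLM {m : ℕ} (a b : Cl m) (T : Distr m) :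
    mulLeftCLM a ∘L (mulLeftCLM b ∘L T) = mulLeftCLM (a * b) ∘L T := by
  ext φ
  simp [mul_assoc]

theorem dirac_add {m : ℕ} (S T : Distr m) : dirac (S + T) = dirac S + dirac T := by
  ext φ
  simp only [dirac_apply, _root_.add_apply, mul_add, Finset.sum_add_distrib, neg_add]

theorem dirac_smul {m : ℕ} (c : ℝ) (T : Distr m) : dirac (c • T) = c • dirac T := by
  ext φ
  simp only [dirac_apply, _root_.smul_apply, mul_smul_comm, ← Finset.smul_sum, smul_neg]

/-- The sign comes from moving `ē₀` past each `e_j`. It is the source of the alternation between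
even and odd orders. -/
theorem dirac_mulLeft_e0bar {m : ℕ} (T : Distr m) :
    dirac (mulLeftCLM (e0bar m) ∘L T) = -(mulLeftCLM (e0bar m) ∘L dirac T) := by
  ext φ
  simp only [dirac_apply, ContinuousLinearMap.comp_apply, _root_.neg_apply, mulLeftCLM_apply,
    mul_neg, Finset.mul_sum, ← mul_assoc, e0bar_mul_e_succ, neg_mul, Finset.sum_neg_distrib,
    neg_neg]

theorem iterate_dirac_add_smul {m : ℕ} (k : ℕ) (a b : ℝ) (S T : Distr m) :
    dirac^[k] (a • S + b • T) = a • dirac^[k] S + b • dirac^[k] T := by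
  induction k with
  | zero => rfl
  | succ k ih => simp only [Function.iterate_succ_apply', ih, dirac_add, dirac_smul]

theorem iterate_two_mul_dirac_mulLeft_e0bar {m : ℕ} (k : ℕ) (T : Distr m) :
    dirac^[2 * k] (mulLeftCLM (e0bar m) ∘L T) = mulLeftCLM (e0bar m) ∘L dirac^[2 * k] T := by
  induction k with
  | zero => rfl
  | succ k ih =>
    have h : ∀ S : Distr m, dirac (-S) = -dirac S := fun S => by
      simpa using dirac_smul (-1) S
    simp only [Nat.mul_succ, Function.iterate_succ_apply', ih, dirac_mulLeft_e0bar, h, neg_neg]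

/-- The operator `-ē₀ ∂` on distributions. -/
noncomputable def tangential {m : ℕ} (T : Distr m) : Distr m :=
  -(mulLeftCLM (e0bar m) ∘L dirac T)

theorem tangential_tangential {m : ℕ} (T : Distr m) :
    tangential (tangential T) = dirac (dirac T) := by
  have h : ∀ S : Distr m, dirac (-S) = -dirac S := fun S => by simpa using dirac_smul (-1) S
  rw [tangential, tangential, h, dirac_mulLeft_e0bar, neg_neg, mulLeftCLM_comp_mulLeftCLM,
    e0bar_mul_self]
  ext φ
  simp

theorem iterate_two_mul_tangential {m : ℕ} (k : ℕ) (T : Distr m) :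
    tangential^[2 * k] T = dirac^[2 * k] T := by
  induction k with
  | zero => rfl
  | succ k ih => simp only [Nat.mul_succ, Function.iterate_succ_apply', ih, tangential_tangential]

theorem hasBoundaryValue_potential {m : ℕ} {l : Filter ℝ} (hl : ∀ᶠ a in l, a ≠ 0) {T : Distr m}
    (hT : HasBoundaryValue l (cauchyKernel m) T) (k : ℕ) :
    HasBoundaryValue l (potential m k) (tangential^[k] T) := by
  induction k with
  | zero => exact hT
  | succ k ih =>
    rw [Function.iterate_succ_apply']
    obtain ⟨hS, hL, -⟩ := potential_properties m k
    refine ih.of_partialD hl hS hL fun x hx => ?_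
    rw [potential_succ, crConj_eq_partialD (hL x hx)]

theorem tangential_iterate_even {m : ℕ} [NeZero m] (k : ℕ) (c : ℝ) :
    tangential^[2 * k]
        (c • delta m + (1 / 2 : ℝ) • (mulLeftCLM (e0bar m) ∘L hilbertKernel m)) =
      c • dirac^[2 * k] (delta m) +
        (1 / 2 : ℝ) • (mulLeftCLM (e0bar m) ∘L dirac^[2 * k] (hilbertKernel m)) := by
  rw [iterate_two_mul_tangential, iterate_dirac_add_smul, iterate_two_mul_dirac_mulLeft_e0bar]

/-- One more `-ē₀ ∂` puts a factor `ē₀` in front of the delta part and removes the one in front of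
the Hilbert part, since `ē₀² = -1`. -/
theorem tangential_iterate_odd {m : ℕ} [NeZero m] (k : ℕ) (c : ℝ) :
    tangential^[2 * k + 1]
        (c • delta m + (1 / 2 : ℝ) • (mulLeftCLM (e0bar m) ∘L hilbertKernel m)) =
      (-c) • (mulLeftCLM (e0bar m) ∘L dirac^[2 * k + 1] (delta m)) -
        (1 / 2 : ℝ) • dirac^[2 * k + 1] (hilbertKernel m) := by
  rw [Function.iterate_succ_apply', tangential_iterate_even, tangential, dirac_add, dirac_smul,
    dirac_smul, dirac_mulLeft_e0bar, Function.iterate_succ_apply', Function.iterate_succ_apply']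
  ext φ
  simp only [_root_.neg_apply, _root_.sub_apply, _root_.add_apply, _root_.smul_apply,
    ContinuousLinearMap.comp_apply, map_add, map_smul, map_neg, mulLeftCLM_apply]
  rw [← mul_assoc, e0bar_mul_self]
  simp only [neg_mul, one_mul, neg_neg, neg_smul, neg_add, sub_eq_add_neg]

theorem hasBoundaryValue_potential_upper (m : ℕ) [NeZero m] (k : ℕ) :
    HasBoundaryValue (𝓝[>] 0) (potential m k) (tangential^[k]
      ((1 / 2 : ℝ) • delta m + (1 / 2 : ℝ) • (mulLeftCLM (e0bar m) ∘L hilbertKernel m))) :=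
  hasBoundaryValue_potential (by filter_upwards [self_mem_nhdsWithin] with a ha using ne_of_gt ha)
    (hasBoundaryValue_cauchyKernel_upper m) k

theorem hasBoundaryValue_potential_lower (m : ℕ) [NeZero m] (k : ℕ) :
    HasBoundaryValue (𝓝[<] 0) (potential m k) (tangential^[k]
      ((-(1 / 2) : ℝ) • delta m + (1 / 2 : ℝ) • (mulLeftCLM (e0bar m) ∘L hilbertKernel m))) :=
  hasBoundaryValue_potential (by filter_upwards [self_mem_nhdsWithin] with a ha using ne_of_lt ha)
    (hasBoundaryValue_cauchyKernel_lower m) k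

/-! ### The four jump relations -/

theorem isJump_odd_delta (m : ℕ) [NeZero m] (k : ℕ) :
    IsJump (dirac^[2 * k + 1] (delta m)) (fun x => e0bar m * potential m (2 * k + 1) x)
      (fun x => e0bar m * potential m (2 * k + 1) x) := by
  refine ⟨_, _, (hasBoundaryValue_potential_upper m _).mul_left _,
    (hasBoundaryValue_potential_lower m _).mul_left _, ?_⟩
  rw [tangential_iterate_odd, tangential_iterate_odd]
  ext φ
  simp only [_root_.sub_apply, _root_.smul_apply,
    ContinuousLinearMap.comp_apply, map_sub, map_smul, mulLeftCLM_apply]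
  rw [← mul_assoc, e0bar_mul_self, neg_one_mul]
  module

/-- The sign in the upper function turns the jump into minus the sum of both boundary values, in
which the delta parts cancel. -/
theorem isJump_odd_hilbertKernel (m : ℕ) [NeZero m] (k : ℕ) :
    IsJump (dirac^[2 * k + 1] (hilbertKernel m)) (fun x => -potential m (2 * k + 1) x)
      (potential m (2 * k + 1)) := by
  refine ⟨_, _, (hasBoundaryValue_potential_upper m _).neg,
    hasBoundaryValue_potential_lower m _, ?_⟩
  rw [tangential_iterate_odd, tangential_iterate_odd]
  ext φ
  simp only [_root_.sub_apply, _root_.smul_apply, _root_.neg_apply]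
  module

theorem isJump_even_delta (m : ℕ) [NeZero m] (k : ℕ) :
    IsJump (dirac^[2 * k] (delta m)) (potential m (2 * k)) (potential m (2 * k)) := by
  refine ⟨_, _, hasBoundaryValue_potential_upper m _, hasBoundaryValue_potential_lower m _, ?_⟩
  rw [tangential_iterate_even, tangential_iterate_even]
  ext φ
  simp only [_root_.sub_apply, _root_.smul_apply, _root_.add_apply]
  module

/-- Since `ē₀ = -e₀`, the jump is `e₀` times the sum of both boundary values: the delta parts cancel
and `e₀ ē₀ = 1` frees the Hilbert part. -/
theorem isJump_even_hilbertKernel (m : ℕ) [NeZero m] (k : ℕ) :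
    IsJump (dirac^[2 * k] (hilbertKernel m)) (fun x => e 0 * potential m (2 * k) x)
      (fun x => e0bar m * potential m (2 * k) x) := by
  refine ⟨_, _, (hasBoundaryValue_potential_upper m _).mul_left _,
    (hasBoundaryValue_potential_lower m _).mul_left _, ?_⟩
  rw [tangential_iterate_even, tangential_iterate_even]
  ext φ
  simp only [_root_.sub_apply, _root_.smul_apply, _root_.add_apply,
    ContinuousLinearMap.comp_apply, map_add, map_smul, mulLeftCLM_apply]
  rw [← mul_assoc, ← mul_assoc, e_zero_mul_e0bar, e0bar_mul_self, e0bar_eq, neg_one_mul, one_mul,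
    neg_mul]
  module

end CliffordHyper

theorem mainTheorem1 (m : ℕ) [NeZero m] (l : ℕ) (hl : 1 ≤ l) :
    (LeftMonogenicOn (potential m (2 * l - 1)) {0}ᶜ ∧
      RightMonogenicOn (potential m (2 * l - 1)) {0}ᶜ ∧
      LeftMonogenicOn (potential m (2 * l)) {0}ᶜ ∧
      RightMonogenicOn (potential m (2 * l)) {0}ᶜ) ∧
    RightRepresents (dirac^[2 * l - 1] (delta m))
      (fun x => e0bar m * potential m (2 * l - 1) x)
      (fun x => e0bar m * potential m (2 * l - 1) x) ∧
    (LeftRepresents (dirac^[2 * l - 1] (hilbertKernel m))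
      (fun x => -potential m (2 * l - 1) x) (potential m (2 * l - 1)) ∧
     RightRepresents (dirac^[2 * l - 1] (hilbertKernel m))
      (fun x => -potential m (2 * l - 1) x) (potential m (2 * l - 1))) ∧
    (LeftRepresents (dirac^[2 * l] (delta m)) (potential m (2 * l)) (potential m (2 * l)) ∧
     RightRepresents (dirac^[2 * l] (delta m)) (potential m (2 * l)) (potential m (2 * l))) ∧
    RightRepresents (dirac^[2 * l] (hilbertKernel m))
      (fun x => e 0 * potential m (2 * l) x)
      (fun x => e0bar m * potential m (2 * l) x) := by
  -- `potential m n` is `C_{-n-1}`, so `C_{-2l}` has the odd index `2l - 1`; here `l ≥ 1` makes the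
  -- truncated subtraction exact.
  obtain ⟨k, hk⟩ : ∃ k, 2 * l - 1 = 2 * k + 1 := ⟨l - 1, by omega⟩
  rw [hk]
  have hLu := fun n => (leftMonogenicOn_potential m n).mono (upper_subset m)
  have hLl := fun n => (leftMonogenicOn_potential m n).mono (lower_subset m)
  have hRu := fun n => (rightMonogenicOn_potential m n).mono (upper_subset m)
  have hRl := fun n => (rightMonogenicOn_potential m n).mono (lower_subset m)
  exact ⟨⟨leftMonogenicOn_potential m _, rightMonogenicOn_potential m _,
      leftMonogenicOn_potential m _, rightMonogenicOn_potential m _⟩,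
    ⟨(hRu _).mul_left (isOpen_upper m) _, (hRl _).mul_left (isOpen_lower m) _,
      isJump_odd_delta m k⟩,
    ⟨⟨(hLu _).neg, hLl _, isJump_odd_hilbertKernel m k⟩,
      ⟨(hRu _).neg, hRl _, isJump_odd_hilbertKernel m k⟩⟩,
    ⟨⟨hLu _, hLl _, isJump_even_delta m l⟩, ⟨hRu _, hRl _, isJump_even_delta m l⟩⟩,
    ⟨(hRu _).mul_left (isOpen_upper m) _, (hRl _).mul_left (isOpen_lower m) _,
      isJump_even_hilbertKernel m l⟩⟩
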